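/- Let $\mathfrak g=\mathfrak g_{\bar 0}\oplus\mathfrak g_{\bar 1}$ be one of the complex Lie superalgebras $\mathfrak{gl}(m|n)$, or a finite-dimensional contragredient Lie superalgebra with indecomposable Cartan matrix, that is, $\mathfrak{sl}(m|n)$ ($m\ne n$), $\mathfrak{gl}(n|n)$, $\mathfrak{osp}(m|2n)$, $D(2,1,\alpha)$, $F(4)$ or $G(3)$. Let $\mathfrak h\subset\mathfrak g_{\bar 0}$ be a Cartan subalgebra and $(\cdot,\cdot)$ a nondegenerate even supersymmetric invariant bilinear form. For a finite-dimensional $\mathfrak g$-module $M$ with weight spaces $M^\mu$, $\mu\in\mathfrak h^*$, let $\operatorname{sch}M=\sum_\mu(\dim M^\mu_{\bar 0}-\dim M^\mu_{\bar 1})e^\mu$; let $\mathcal J_{\mathfrak g}$ be the ring of all supercharacters of finite-dimensional modules, and view $f=\sum c_\mu e^\mu\in\mathcal J_{\mathfrak g}$ as the function $f(t)=\sum c_\mu e^{\mu(t)}$ on $\mathfrak h$. Let $B=\{\beta_1,\dots,\beta_k\}$ be a set of isotropic odd roots with $(\beta_i,\beta_j)=0$ for all $i,j$ and $\beta_i\ne\pm\beta_j$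 for $i\ne j$, and let $x=x_{\beta_1}+\dots+x_{\beta_k}$ with $0\ne x_{\beta_i}\in\mathfrak g_{\beta_i}$. Then $[x,x]=0$. Put $\mathfrak g^x=\{a:[x,a]=0\}$, $\mathfrak g_x=\mathfrak g^x/[x,\mathfrak g]$, $\mathfrak h^x=\mathfrak h\cap\mathfrak g^x$, let $\mathfrak h_x$ be the image of $\mathfrak h^x$ in $\mathfrak g_x$, and for a $\mathfrak g$-module $M$ let $M_x=\operatorname{Ker}_M x/xM$, a $\mathfrak g_x$-module. There is a unique ring homomorphism $ds_x:\mathcal J_{\mathfrak g}\to\mathcal J_{\mathfrak g_x}$ with $ds_x(\operatorname{sch}M)=\operatorname{sch}M_x$ for every finite-dimensional $M$ (supercharacters of $\mathfrak g_x$-modules being taken with respect to $\mathfrak h_x$), and for every $f\in\mathcal J_{\mathfrak g}$: 1. $ds_x(f)=f|_{\mathfrak h_x}$, where $\mathfrak g_x$ is embedded in $\mathfrak g^x$ as any graded subalgebra with $\mathfrak g^x=[x,\mathfrak g]\oplus\mathfrak g_x$ and $\mathfrak h_x$ is identified with $\mathfrak h\cap\mathfrak g_x$. 2. Write $x_i=e^{\varepsilon_i}$,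 $y_j=e^{\delta_j}$ for functionals $\varepsilon_i,\delta_j\in\mathfrak h^*$ and express $f$ in these variables. If $B=\{\varepsilon_1-\delta_1\}$, then $ds_x(f)=f|_{x_1=y_1}$. If $B=\{\frac12(\varepsilon_1+\varepsilon_2+\varepsilon_3-\delta_1)\}$ (as for $F(4)$, with $x_i=e^{\varepsilon_i/2}$, $y_1=e^{\delta_1/2}$), then $ds_x(f)=f|_{y_1=x_1x_2x_3}$. If $B=\{\varepsilon_1-\varepsilon_2-\varepsilon_3\}$ (as for $D(2,1,\alpha)$), then $ds_x(f)=f|_{x_1=x_2x_3}$. 3. If $\beta_i=a_i\varepsilon_{r_i}-b_i\delta_{s_i}$ with $a_i,b_i\in\{\pm1\}$ for $i=1,\dots,k$, then $ds_x(f)$ is obtained from $f$ by substituting $x_{r_i}^{a_i}=y_{s_i}^{b_i}$, $i=1,\dots,k$. 4. $ds_x(f)=f|_{\beta_1=\dots=\beta_k=0}$; here $\{t\in\mathfrak h:\beta_1(t)=\dots=\beta_k(t)=0\}=\mathfrak h^x$. In 2–4 the right-hand sides are functions on $\mathfrak h^x$, and the equality means that they are the pull-back of the function $ds_x(f)$ on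 $\mathfrak h_x$ along the projection $\mathfrak h^x\to\mathfrak h_x$. -/

import Mathlib

noncomputable section

namespace SuperLie

/-! ## Lie superalgebras and their modules over the complex numbers -/

/-- The sign `(-1)^(i j)` attached to two parities. -/
def superSign (i j : ZMod 2) : ℂ := if i = 1 ∧ j = 1 then -1 else 1

/-- A complex vector space with a `ℤ/2`-grading. -/
class SuperSpace (V : Type*) [AddCommGroup V] [Module ℂ V] where
  part : ZMod 2 → Submodule ℂ V
  isCompl_part : IsCompl (part 0) (part 1)

/-- A Lie superalgebra over `ℂ`. -/
class LieSuperalgebra (L : Type*) [AddCommGroup L] [Module ℂ L] extends SuperSpace L where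
  bracket : L →ₗ[ℂ] L →ₗ[ℂ] L
  bracket_mem : ∀ {i j : ZMod 2} {a b : L}, a ∈ part i → b ∈ part j → bracket a b ∈ part (i + j)
  bracket_skew : ∀ {i j : ZMod 2} {a b : L}, a ∈ part i → b ∈ part j →
    bracket a b = -(superSign i j • bracket b a)
  bracket_jacobi : ∀ {i j : ZMod 2} {a b : L} (c : L), a ∈ part i → b ∈ part j →
    bracket a (bracket b c) = bracket (bracket a b) c + superSign i j • bracket b (bracket a c)

open SuperSpace LieSuperalgebra

/-- A module over a Lie superalgebra; the grading is part of the data. -/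
class LieSupermodule (L M : Type*) [AddCommGroup L] [Module ℂ L] [LieSuperalgebra L]
    [AddCommGroup M] [Module ℂ M] [SuperSpace M] where
  act : L →ₗ[ℂ] Module.End ℂ M
  act_mem : ∀ {i j : ZMod 2} {a : L} {m : M}, a ∈ part i → m ∈ part j → act a m ∈ part (i + j)
  act_bracket : ∀ {i j : ZMod 2} {a b : L} (m : M), a ∈ part i → b ∈ part j →
    act (bracket a b) m = act a (act b m) - superSign i j • act b (act a m)

open LieSupermodule

/-- The adjoint module. -/
instance adjointModule (L : Type*) [AddCommGroup L] [Module ℂ L] [LieSuperalgebra L] :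
    LieSupermodule L L where
  act := bracket
  act_mem := bracket_mem
  act_bracket := fun m ha hb => by rw [bracket_jacobi m ha hb]; simp

/-- The odd part of a Lie superalgebra. -/
abbrev OddPart (L : Type*) [AddCommGroup L] [Module ℂ L] [LieSuperalgebra L] : Type _ :=
  (part 1 : Submodule ℂ L)

section Graded

variable {V : Type*} [AddCommGroup V] [Module ℂ V] [SuperSpace V]

theorem exists_decomp (v : V) :
    ∃ v0 ∈ part (V := V) 0, ∃ v1 ∈ part (V := V) 1, v0 + v1 = v := by
  have h : v ∈ part (V := V) 0 ⊔ part (V := V) 1 := by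
    rw [isCompl_part.sup_eq_top]; trivial
  exact Submodule.mem_sup.mp h

theorem eq_zero_of_add_eq_zero {a b : V} (ha : a ∈ part (V := V) 0) (hb : b ∈ part (V := V) 1)
    (h : a + b = 0) : a = 0 ∧ b = 0 := by
  have hab : a = -b := eq_neg_of_add_eq_zero_left h
  have h0 : a = 0 := by
    have : a ∈ part (V := V) 0 ⊓ part (V := V) 1 :=
      ⟨ha, hab ▸ (part (V := V) 1).neg_mem hb⟩
    rwa [isCompl_part.inf_eq_bot, Submodule.mem_bot] at this
  refine ⟨h0, ?_⟩
  rw [h0, zero_add] at h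
  exact h

end Graded

/-! ## The Duflo–Serganova construction -/

section DS

variable {L : Type*} [AddCommGroup L] [Module ℂ L] [LieSuperalgebra L] (x : OddPart L)
  (M : Type*) [AddCommGroup M] [Module ℂ M] [SuperSpace M] [LieSupermodule L M]

/-- The kernel of the odd element `x` in the module `M`. -/
def kerx : Submodule ℂ M := LinearMap.ker (act (x : L) : Module.End ℂ M)

/-- The image `x M`. -/
def imx : Submodule ℂ M := LinearMap.range (act (x : L) : Module.End ℂ M)

/-- `M_x = Ker x / x M`. The quotient is by `x M ∩ Ker x`, which is `x M` when `[x, x] = 0`. -/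
def DSMod : Type _ := kerx x M ⧸ (imx x M).submoduleOf (kerx x M)

instance : AddCommGroup (DSMod x M) :=
  inferInstanceAs (AddCommGroup (kerx x M ⧸ (imx x M).submoduleOf (kerx x M)))

instance : Module ℂ (DSMod x M) :=
  inferInstanceAs (Module ℂ (kerx x M ⧸ (imx x M).submoduleOf (kerx x M)))

instance [FiniteDimensional ℂ M] : FiniteDimensional ℂ (DSMod x M) :=
  inferInstanceAs (FiniteDimensional ℂ (kerx x M ⧸ (imx x M).submoduleOf (kerx x M)))

/-- The class in `M_x` of an element of `Ker x`. -/
def DSMod.mk : kerx x M →ₗ[ℂ] DSMod x M := ((imx x M).submoduleOf (kerx x M)).mkQ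

/-- `g_x = g^x / [x, g]`, the same construction for the adjoint module. -/
abbrev DSAlg : Type _ := DSMod x L

variable {x M}

theorem mem_kerx {m : M} : m ∈ kerx x M ↔ act (x : L) m = 0 := LinearMap.mem_ker

theorem mem_imx {m : M} : m ∈ imx x M ↔ ∃ w : M, act (x : L) w = m := LinearMap.mem_range

theorem DSMod.mk_surjective : Function.Surjective (DSMod.mk x M) := Submodule.mkQ_surjective _

theorem DSMod.mk_eq_zero {m : kerx x M} : DSMod.mk x M m = 0 ↔ (m : M) ∈ imx x M := by
  exact Submodule.Quotient.mk_eq_zero ((imx x M).submoduleOf (kerx x M))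

theorem act_odd_mem0 {m : M} (hm : m ∈ part (V := M) 0) :
    act (x : L) m ∈ part (V := M) 1 := by
  have := act_mem (L := L) x.2 hm
  simpa using this

theorem act_odd_mem1 {m : M} (hm : m ∈ part (V := M) 1) :
    act (x : L) m ∈ part (V := M) 0 := by
  have := act_mem (L := L) x.2 hm
  rwa [show (1 + 1 : ZMod 2) = 0 from rfl] at this

theorem kerx_graded {a b : M} (ha : a ∈ part (V := M) 0) (hb : b ∈ part (V := M) 1)
    (h : a + b ∈ kerx x M) : a ∈ kerx x M ∧ b ∈ kerx x M := by
  rw [mem_kerx, map_add, add_comm] at h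
  have := eq_zero_of_add_eq_zero (act_odd_mem1 hb) (act_odd_mem0 ha) h
  exact ⟨mem_kerx.2 this.2, mem_kerx.2 this.1⟩

theorem imx_graded {a b : M} (ha : a ∈ part (V := M) 0) (hb : b ∈ part (V := M) 1)
    (h : a + b ∈ imx x M) : a ∈ imx x M ∧ b ∈ imx x M := by
  obtain ⟨w, hw⟩ := mem_imx.1 h
  obtain ⟨w0, h0, w1, h1, rfl⟩ := exists_decomp w
  rw [map_add] at hw
  have key := eq_zero_of_add_eq_zero
    ((part (V := M) 0).sub_mem (act_odd_mem1 (x := x) h1) ha)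
    ((part (V := M) 1).sub_mem (act_odd_mem0 (x := x) h0) hb) (by
      rw [sub_add_sub_comm, sub_eq_zero, ← hw, add_comm])
  exact ⟨mem_imx.2 ⟨w1, sub_eq_zero.1 key.1⟩, mem_imx.2 ⟨w0, sub_eq_zero.1 key.2⟩⟩

instance : SuperSpace (DSMod x M) where
  part := fun i => ((part (V := M) i).comap (kerx x M).subtype).map (DSMod.mk x M)
  isCompl_part := by
    constructor
    · rw [Submodule.disjoint_def]
      rintro _ ⟨a, ha, rfl⟩ ⟨b, hb, hab⟩
      have h0 : DSMod.mk x M (a - b) = 0 := by rw [map_sub, hab, sub_self]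
      rw [DSMod.mk_eq_zero, Submodule.coe_sub, sub_eq_add_neg] at h0
      exact DSMod.mk_eq_zero.2 (imx_graded ha ((part (V := M) 1).neg_mem hb) h0).1
    · rw [codisjoint_iff, eq_top_iff]
      rintro v -
      obtain ⟨⟨m, hm⟩, rfl⟩ := DSMod.mk_surjective v
      obtain ⟨a, ha, b, hb, rfl⟩ := exists_decomp m
      obtain ⟨ka, kb⟩ := kerx_graded ha hb hm
      refine Submodule.mem_sup.2 ⟨DSMod.mk x M ⟨a, ka⟩, ⟨⟨a, ka⟩, ha, rfl⟩,
        DSMod.mk x M ⟨b, kb⟩, ⟨⟨b, kb⟩, hb, rfl⟩, ?_⟩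
      rw [← map_add]
      rfl

theorem DSMod.mem_part {i : ZMod 2} {v : DSMod x M} (hv : v ∈ part (V := DSMod x M) i) :
    ∃ m : kerx x M, (m : M) ∈ part (V := M) i ∧ DSMod.mk x M m = v := hv

theorem DSMod.mk_mem_part {i : ZMod 2} {m : kerx x M} (hm : (m : M) ∈ part (V := M) i) :
    DSMod.mk x M m ∈ part (V := DSMod x M) i := ⟨m, hm, rfl⟩

/-- Moving `x` past a homogeneous element of `g`. -/
theorem act_x_act {i : ZMod 2} {a : L} (ha : a ∈ part (V := L) i) (m : M) :
    act (x : L) (act a m) =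
      act (bracket (x : L) a) m + superSign 1 i • act a (act (x : L) m) := by
  rw [act_bracket m x.2 ha]
  abel

theorem act_mem_kerx {a : L} (ha : a ∈ kerx x L) {m : M} (hm : m ∈ kerx x M) :
    act a m ∈ kerx x M := by
  obtain ⟨a0, h0, a1, h1, rfl⟩ := exists_decomp a
  obtain ⟨k0, k1⟩ := kerx_graded h0 h1 ha
  have k0' : bracket (x : L) a0 = 0 := mem_kerx.1 k0
  have k1' : bracket (x : L) a1 = 0 := mem_kerx.1 k1
  rw [mem_kerx] at hm ⊢
  rw [map_add, LinearMap.add_apply, map_add, act_x_act h0, act_x_act h1, hm, k0', k1']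
  simp

theorem act_mem_imx_right {a : L} (ha : a ∈ kerx x L) {m : M} (hm : m ∈ imx x M) :
    act a m ∈ imx x M := by
  obtain ⟨a0, h0, a1, h1, rfl⟩ := exists_decomp a
  obtain ⟨k0, k1⟩ := kerx_graded h0 h1 ha
  have k0' : bracket (x : L) a0 = 0 := mem_kerx.1 k0
  have k1' : bracket (x : L) a1 = 0 := mem_kerx.1 k1
  obtain ⟨w, rfl⟩ := mem_imx.1 hm
  refine mem_imx.2 ⟨act a0 w - act a1 w, ?_⟩
  rw [map_sub, act_x_act h0, act_x_act h1, k0', k1']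
  simp [superSign]

theorem act_mem_imx_left {a : L} (ha : a ∈ imx x L) {m : M} (hm : m ∈ kerx x M) :
    act a m ∈ imx x M := by
  obtain ⟨w, rfl⟩ := mem_imx.1 ha
  obtain ⟨w0, h0, w1, h1, rfl⟩ := exists_decomp w
  rw [mem_kerx] at hm
  refine mem_imx.2 ⟨act w0 m + act w1 m, ?_⟩
  rw [map_add, act_x_act h0, act_x_act h1, hm]
  rw [map_add, map_add, LinearMap.add_apply]
  simp only [map_zero, smul_zero, add_zero]
  rfl

variable (x M)

/-- The action of `g^x` on `Ker x`, followed by the projection to `M_x`. -/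
def DSMod.preAct : kerx x L →ₗ[ℂ] kerx x M →ₗ[ℂ] DSMod x M :=
  LinearMap.mk₂ ℂ (fun a m => DSMod.mk x M ⟨act (a : L) (m : M), act_mem_kerx a.2 m.2⟩)
    (fun a b m => by rw [← map_add]; congr 1; ext; simp)
    (fun c a m => by rw [← map_smul]; congr 1; ext; simp)
    (fun a m n => by rw [← map_add]; congr 1; ext; simp)
    (fun c a m => by rw [← map_smul]; congr 1; ext; simp)

/-- The induced action of `g_x` on `M_x`. -/
def DSMod.dsAct : DSAlg x →ₗ[ℂ] DSMod x M →ₗ[ℂ] DSMod x M :=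
  LinearMap.liftQ₂ ((imx x L).submoduleOf (kerx x L)) ((imx x M).submoduleOf (kerx x M))
    (DSMod.preAct x M)
    (fun _ ha => LinearMap.mem_ker.2 (LinearMap.ext fun m =>
      DSMod.mk_eq_zero.2 (act_mem_imx_left ha m.2)))
    (fun _ hm => LinearMap.mem_ker.2 (LinearMap.ext fun a =>
      DSMod.mk_eq_zero.2 (act_mem_imx_right a.2 hm)))

variable {x M}

theorem DSMod.dsAct_mk (a : kerx x L) (m : kerx x M) :
    DSMod.dsAct x M (DSMod.mk x L a) (DSMod.mk x M m) =
      DSMod.mk x M ⟨act (a : L) (m : M), act_mem_kerx a.2 m.2⟩ := rfl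

/-- The Lie superalgebra structure of `g_x`. -/
instance : LieSuperalgebra (DSAlg x) where
  bracket := DSMod.dsAct x L
  bracket_mem := by
    intro i j a b ha hb
    obtain ⟨a, ka, rfl⟩ := DSMod.mem_part ha
    obtain ⟨b, kb, rfl⟩ := DSMod.mem_part hb
    rw [DSMod.dsAct_mk]
    exact DSMod.mk_mem_part (bracket_mem ka kb)
  bracket_skew := by
    intro i j a b ha hb
    obtain ⟨a, ka, rfl⟩ := DSMod.mem_part ha
    obtain ⟨b, kb, rfl⟩ := DSMod.mem_part hb
    rw [DSMod.dsAct_mk, DSMod.dsAct_mk, ← map_smul, ← map_neg]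
    congr 1
    ext
    exact bracket_skew ka kb
  bracket_jacobi := by
    intro i j a b c ha hb
    obtain ⟨a, ka, rfl⟩ := DSMod.mem_part ha
    obtain ⟨b, kb, rfl⟩ := DSMod.mem_part hb
    obtain ⟨c, rfl⟩ := DSMod.mk_surjective c
    simp only [DSMod.dsAct_mk]
    rw [← map_smul, ← map_add]
    congr 1
    ext
    exact bracket_jacobi (c : L) ka kb

/-- The `g_x`-module structure of `M_x`. -/
instance : LieSupermodule (DSAlg x) (DSMod x M) where
  act := DSMod.dsAct x M
  act_mem := by
    intro i j a m ha hm
    obtain ⟨a, ka, rfl⟩ := DSMod.mem_part ha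
    obtain ⟨m, km, rfl⟩ := DSMod.mem_part hm
    rw [DSMod.dsAct_mk]
    exact DSMod.mk_mem_part (act_mem ka km)
  act_bracket := by
    intro i j a b m ha hb
    obtain ⟨a, ka, rfl⟩ := DSMod.mem_part ha
    obtain ⟨b, kb, rfl⟩ := DSMod.mem_part hb
    obtain ⟨m, rfl⟩ := DSMod.mk_surjective m
    change DSMod.dsAct x M (DSMod.dsAct x L _ _) _ = _
    simp only [DSMod.dsAct_mk]
    rw [← map_smul, ← map_sub]
    congr 1
    ext
    exact act_bracket (m : M) ka kb

end DS

/-! ## Cartan subalgebras, supercharacters and the supercharacter ring -/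

/-- An even abelian subalgebra. -/
structure EvenAbelian (L : Type*) [AddCommGroup L] [Module ℂ L] [LieSuperalgebra L] where
  carrier : Submodule ℂ L
  le_even : carrier ≤ part 0
  abelian : ∀ a ∈ carrier, ∀ b ∈ carrier, bracket a b = 0

section Weights

variable {L : Type*} [AddCommGroup L] [Module ℂ L] [LieSuperalgebra L] (H : EvenAbelian L)

/-- The space of linear functionals on `h`. -/
abbrev EvenAbelian.Weight : Type _ := Module.Dual ℂ H.carrier

/-- The root space `g_α`. -/
def rootSpace (α : H.Weight) : Submodule ℂ L where
  carrier := {a | ∀ t : H.carrier, bracket (t : L) a = α t • a}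
  add_mem' := fun ha hb t => by rw [map_add, ha t, hb t, smul_add]
  zero_mem' := fun t => by simp
  smul_mem' := fun c a ha t => by rw [map_smul, ha t, smul_comm]

/-- `h` is a Cartan subalgebra with a root space decomposition
`g = h ⊕ ⨁_α g_α`. -/
structure EvenAbelian.IsCartan : Prop where
  rootSpace_zero : rootSpace H 0 = H.carrier
  iSup_rootSpace : ⨆ α : H.Weight, rootSpace H α = ⊤

/-- The odd roots. -/
def oddRoots : Set H.Weight :=
  {β | β ≠ 0 ∧ rootSpace H β ≠ ⊥ ∧ rootSpace H β ≤ part 1}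

variable (M : Type*) [AddCommGroup M] [Module ℂ M] [SuperSpace M] [LieSupermodule L M]

/-- The weight space `M^μ`, taken as a simultaneous generalized eigenspace so that every
finite-dimensional module is the sum of its weight spaces; when `h` acts diagonalizably this is
the space of `m` with `t m = μ(t) m` for all `t` in `h`. -/
def weightSpace (μ : H.Weight) : Submodule ℂ M :=
  ⨅ t : H.carrier, (act (t : L) : Module.End ℂ M).maxGenEigenspace (μ t)

/-- `dim M_0^μ - dim M_1^μ`. -/
def superMult (μ : H.Weight) : ℤ :=
  (Module.finrank ℂ ↥(weightSpace H M μ ⊓ part 0) : ℤ) -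
    (Module.finrank ℂ ↥(weightSpace H M μ ⊓ part 1) : ℤ)

theorem act_commute (s t : H.carrier) :
    Commute (act (s : L) : Module.End ℂ M) (act (t : L) : Module.End ℂ M) := by
  ext m
  have h := act_bracket (L := L) m (H.le_even s.2) (H.le_even t.2)
  rw [H.abelian s s.2 t t.2] at h
  simp only [map_zero, LinearMap.zero_apply, superSign] at h
  simp only [Module.End.mul_apply]
  simpa using (sub_eq_zero.1 (by simpa using h.symm))

theorem superMult_support_finite [FiniteDimensional ℂ M] :
    (Function.support (superMult H M)).Finite := by
  have hind := Module.End.independent_iInf_maxGenEigenspace_of_forall_mapsTo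
    (fun t : H.carrier => (act (t : L) : Module.End ℂ M))
    (fun s t φ => Module.End.mapsTo_maxGenEigenspace_of_comm (act_commute H M t s) φ)
  have hfin := WellFoundedGT.finite_ne_bot_of_iSupIndep hind
  refine (hfin.preimage (f := fun μ : H.Weight => (μ : H.carrier → ℂ))
    DFunLike.coe_injective.injOn).subset ?_
  intro μ hμ hbot
  apply hμ
  have hb : weightSpace H M μ = ⊥ := hbot
  rw [superMult, hb, bot_inf_eq, bot_inf_eq, sub_self]

/-- The supercharacter `sch M = ∑_μ (dim M_0^μ - dim M_1^μ) e^μ`, in the group ring of `h*`. -/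
def sch [FiniteDimensional ℂ M] : AddMonoidAlgebra ℤ H.Weight :=
  AddMonoidAlgebra.ofCoeff (Finsupp.ofSupportFinite (superMult H M) (superMult_support_finite H M))

end Weights

universe u v

/-- The supercharacter ring `J_g`: the ring generated by the supercharacters of the
finite-dimensional modules. (As `sch M + sch N = sch (M ⊕ N)`, `-sch M = sch (Π M)` and
`sch M * sch N = sch (M ⊗ N)`, each element is itself a supercharacter.) -/
def superCharRing {L : Type u} [AddCommGroup L] [Module ℂ L] [LieSuperalgebra L]
    (H : EvenAbelian L) : Subring (AddMonoidAlgebra ℤ H.Weight) :=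
  Subring.closure {f | ∃ (M : Type v) (_ : AddCommGroup M) (_ : Module ℂ M)
    (_ : FiniteDimensional ℂ M) (_ : SuperSpace M) (_ : LieSupermodule L M), sch H M = f}

/-- The class `[M]` in the supercharacter ring. -/
def schClass {L : Type u} [AddCommGroup L] [Module ℂ L] [LieSuperalgebra L]
    (H : EvenAbelian L) (M : Type v) [AddCommGroup M] [Module ℂ M] [FiniteDimensional ℂ M]
    [SuperSpace M] [LieSupermodule L M] : superCharRing.{u, v} H :=
  ⟨sch H M, Subring.subset_closure ⟨M, _, _, _, _, _, rfl⟩⟩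

/-! ## The subalgebra `h_x` and the map `ds_x` -/

section Cartanx

variable {L : Type u} [AddCommGroup L] [Module ℂ L] [LieSuperalgebra L] (H : EvenAbelian L)
  (x : OddPart L)

/-- `h^x = h ∩ g^x`, the elements of `h` that commute with `x`. -/
def hCent : Submodule ℂ H.carrier := (kerx x L).comap H.carrier.subtype

/-- The map `h^x → g_x = g^x / [x, g]`. -/
def hCentToDS : hCent H x →ₗ[ℂ] DSAlg x where
  toFun := fun t => DSMod.mk x L ⟨((t : H.carrier) : L), t.2⟩
  map_add' := fun s t => by rw [← map_add]; rfl
  map_smul' := fun c t => by rw [RingHom.id_apply, ← map_smul]; rfl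

/-- `h_x`, the image of `h^x` in `g_x`. -/
def EvenAbelian.ds : EvenAbelian (DSAlg x) where
  carrier := LinearMap.range (hCentToDS H x)
  le_even := by
    rintro _ ⟨t, rfl⟩
    exact DSMod.mk_mem_part (H.le_even t.1.2)
  abelian := by
    rintro _ ⟨s, rfl⟩ _ ⟨t, rfl⟩
    change DSMod.mk x L ⟨bracket ((s : H.carrier) : L) ((t : H.carrier) : L), _⟩ = 0
    rw [DSMod.mk_eq_zero]
    change bracket ((s : H.carrier) : L) ((t : H.carrier) : L) ∈ _
    rw [H.abelian _ s.1.2 _ t.1.2]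
    exact Submodule.zero_mem _

/-- The projection `h^x → h_x` along `[x, g] ∩ h`. -/
def toHx : hCent H x →ₗ[ℂ] (H.ds x).carrier := (hCentToDS H x).rangeRestrict

/-- `ds` is the map `[M] ↦ [M_x]`. -/
def IsDS (ds : superCharRing.{u, v} H →+* superCharRing.{u, v} (H.ds x)) : Prop :=
  ∀ (M : Type v) [AddCommGroup M] [Module ℂ M] [FiniteDimensional ℂ M] [SuperSpace M]
    [LieSupermodule L M], ds (schClass H M) = schClass (H.ds x) (DSMod x M)

/-- `k` is a copy of `g_x` inside `g^x`: a graded subalgebra with `g^x = [x, g] ⊕ k`. -/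
structure IsEmbeddedDS (k : Submodule ℂ L) : Prop where
  le_cent : k ≤ kerx x L
  bracket_mem : ∀ a ∈ k, ∀ b ∈ k, bracket a b ∈ k
  graded : k = (k ⊓ part 0) ⊔ (k ⊓ part 1)
  disjoint : Disjoint (imx x L) k
  sup_eq : imx x L ⊔ k = kerx x L

variable {x}

/-- For an embedded copy `k` of `g_x`, the subspace `h ∩ k` lies in `h^x`. -/
theorem IsEmbeddedDS.le_hCent {k : Submodule ℂ L} (hk : IsEmbeddedDS x k) :
    k.comap H.carrier.subtype ≤ hCent H x := fun _ ht => hk.le_cent ht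

/-- The identification of `h ∩ k` with the Cartan subalgebra `h_x` of `g_x`. -/
def embeddedToHx {k : Submodule ℂ L} (hk : IsEmbeddedDS x k) :
    ↥(k.comap H.carrier.subtype) →ₗ[ℂ] (H.ds x).carrier :=
  (toHx H x).comp (Submodule.inclusion (hk.le_hCent H))

end Cartanx

/-! ## Elements of the group ring as functions; restriction and substitution -/

/-- The function `t ↦ ∑ c_μ exp (μ(t))` attached to `∑ c_μ e^μ`. -/
def evalAt {V : Type*} [AddCommGroup V] [Module ℂ V]
    (f : AddMonoidAlgebra ℤ (Module.Dual ℂ V)) (t : V) : ℂ :=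
  f.coeff.sum fun μ c => (c : ℂ) * Complex.exp (μ t)

/-- Pull-back of exponential sums along a linear map (restriction, for an inclusion):
`e^μ ↦ e^(μ ∘ φ)`. -/
def pullbackExp {V W : Type*} [AddCommGroup V] [Module ℂ V] [AddCommGroup W] [Module ℂ W]
    (φ : V →ₗ[ℂ] W) :
    AddMonoidAlgebra ℤ (Module.Dual ℂ W) →+* AddMonoidAlgebra ℤ (Module.Dual ℂ V) :=
  AddMonoidAlgebra.mapDomainRingHom ℤ φ.dualMap.toAddMonoidHom

/-- Expressions in variables `z_i` are integral combinations of monomials `∏ z_i^(c i)` with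
complex exponents. This is the ring homomorphism with `z_i^c ↦ e^(c w_i)`. Taking for `w` functionals
on `h`, it puts `z_i = e^(w i)`; taking for `w` exponent vectors, it substitutes the monomial
with exponent vector `w i` for `z_i`. -/
def substMonomials {ν : Type*} [Fintype ν] {W : Type*} [AddCommGroup W] [Module ℂ W]
    (w : ν → W) : AddMonoidAlgebra ℤ (ν → ℂ) →+* AddMonoidAlgebra ℤ W :=
  AddMonoidAlgebra.mapDomainRingHom ℤ (Fintype.linearCombination ℂ w).toAddMonoidHom

/-- The exponent vector of the variable `z_i`. -/
def varExp {ν : Type*} [DecidableEq ν] (i : ν) : ν → ℂ := Pi.single i 1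

/-! ## Invariant forms and isotropic roots -/

/-- A nondegenerate even supersymmetric invariant bilinear form. -/
structure InvariantForm (L : Type*) [AddCommGroup L] [Module ℂ L] [LieSuperalgebra L] where
  form : LinearMap.BilinForm ℂ L
  even : ∀ {i j : ZMod 2} {a b : L}, a ∈ part i → b ∈ part j → i ≠ j → form a b = 0
  supersymm : ∀ {i j : ZMod 2} {a b : L}, a ∈ part i → b ∈ part j →
    form a b = superSign i j * form b a
  invariant : ∀ a b c : L, form (bracket a b) c = form a (bracket b c)
  nondegenerate : form.Nondegenerate

section Roots

variable {L : Type*} [AddCommGroup L] [Module ℂ L] [LieSuperalgebra L] (Φ : InvariantForm L)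
  (H : EvenAbelian L)

/-- `t` is the element `t_α` of `h` with `(t_α, s) = α(s)` for all `s` in `h`. -/
def InvariantForm.Represents (t : H.carrier) (α : H.Weight) : Prop :=
  ∀ s : H.carrier, Φ.form (t : L) (s : L) = α s

/-- `(α, β) = 0` for the induced form `(α, β) = (t_α, t_β)` on `h*`. -/
def InvariantForm.Orthogonal (α β : H.Weight) : Prop :=
  ∃ s t : H.carrier, Φ.Represents H s α ∧ Φ.Represents H t β ∧ Φ.form (s : L) (t : L) = 0

/-- `{β_1, …, β_k}` is a set of mutually orthogonal isotropic roots with `β_i ≠ ± β_j`. -/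
structure IsIsotropicSet {k : ℕ} (β : Fin k → H.Weight) : Prop where
  odd_root : ∀ i, β i ∈ oddRoots H
  orthogonal : ∀ i j, Φ.Orthogonal H (β i) (β j)
  ne : ∀ i j, i ≠ j → β i ≠ β j ∧ β i ≠ -β j

end Roots

/-! ## The class of Lie superalgebras -/

section Class

variable {L : Type*} [AddCommGroup L] [Module ℂ L] [LieSuperalgebra L] (H : EvenAbelian L)

/-- `L` is the contragredient Lie superalgebra of the Cartan matrix `A` and the parity function
`p`, with Cartan subalgebra `h`: `h` is a minimal realization of `A`, `L` is generated by `h` and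
Chevalley generators `e_i`, `f_i`, and no nonzero ideal of `L` meets `h` trivially. -/
def IsContragredient {ι : Type} [Fintype ι] [DecidableEq ι] (A : Matrix ι ι ℂ) (p : ι → ZMod 2) :
    Prop :=
  ∃ (hh : ι → H.carrier) (α : ι → H.Weight) (e f : ι → L),
    LinearIndependent ℂ hh ∧ LinearIndependent ℂ α ∧
    Module.finrank ℂ H.carrier + A.rank = 2 * Fintype.card ι ∧
    (∀ i j, α j (hh i) = A i j) ∧
    (∀ i, e i ∈ part (p i) ∧ f i ∈ part (p i)) ∧
    (∀ i, e i ∈ rootSpace H (α i) ∧ f i ∈ rootSpace H (-α i)) ∧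
    (∀ i j, bracket (e i) (f j) = if i = j then (hh i : L) else 0) ∧
    (∀ K : Submodule ℂ L, H.carrier ≤ K → (∀ i, e i ∈ K ∧ f i ∈ K) →
      (∀ a ∈ K, ∀ b ∈ K, bracket a b ∈ K) → K = ⊤) ∧
    (∀ I : Submodule ℂ L, (∀ a : L, ∀ b ∈ I, bracket a b ∈ I) → I ⊓ H.carrier = ⊥ → I = ⊥)

/-- `A` is not, up to simultaneous reordering of rows and columns, block diagonal. -/
def IsIndecomposable {ι : Type} (A : Matrix ι ι ℂ) : Prop :=
  Nonempty ι ∧ ∀ S : Set ι, S.Nonempty → Sᶜ.Nonempty →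
    ∃ i ∈ S, ∃ j ∈ Sᶜ, A i j ≠ 0 ∨ A j i ≠ 0

/-- The parity of an index of an `(m|n) × (m|n)` matrix. -/
def idxParity {m n : ℕ} : Fin m ⊕ Fin n → ZMod 2 := Sum.elim (fun _ => 0) (fun _ => 1)

/-- `L` is `gl(m|n)`, with `h` the diagonal matrices. -/
def IsGL (m n : ℕ) : Prop :=
  ∃ φ : L ≃ₗ[ℂ] Matrix (Fin m ⊕ Fin n) (Fin m ⊕ Fin n) ℂ,
    (∀ (i : ZMod 2) (a : L), a ∈ part (V := L) i ↔
      ∀ r s, idxParity r + idxParity s ≠ i → φ a r s = 0) ∧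
    (∀ (i j : ZMod 2) (a b : L), a ∈ part (V := L) i → b ∈ part (V := L) j →
      φ (bracket a b) = φ a * φ b - superSign i j • (φ b * φ a)) ∧
    (∀ a : L, a ∈ H.carrier ↔ (φ a).IsDiag)

/-- `L` is `gl(m|n)`, or a contragredient Lie superalgebra with indecomposable invertible Cartan
matrix. Among the finite-dimensional `L` these are `gl(m|n)`, `sl(m|n)` with `m ≠ n`, `osp(m|2n)`,
`D(2,1,α)`, `F(4)`, `G(3)` and the simple Lie algebras: `gl(n|n)` is the only one of the
contragredient Lie superalgebras considered whose Cartan matrix is singular. -/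
def IsContragredientOrGL : Prop :=
  (∃ m n : ℕ, IsGL H m n) ∨
  ∃ (ι : Type) (_ : Fintype ι) (_ : DecidableEq ι) (A : Matrix ι ι ℂ) (p : ι → ZMod 2),
    IsIndecomposable A ∧ IsUnit A.det ∧ IsContragredient H A p

end Class

end SuperLie

end

open SuperLie

universe u v

/-! Everything rests on one identity: on `h^x`, the supercharacter of `M` equals the pull-back of
the supercharacter of `M_x` along `h^x → h_x` (`pullbackExp_sch_DSMod`). It is an Euler
characteristic argument. Once `[x, x] = 0`, the odd element `x` acts on `M` with square zero, and it
commutes with `h^x`. So it is an odd differential on each generalized weight space of `h^x`, with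
homology the matching weight space of `M_x`, and superdimension is unchanged by passing to homology.
Restricting exponentials from `h` to `h^x` merges weights that agree on `h^x`, exactly as the weight
spaces merge (`jointDim_comp`).

The projection `h^x → h_x` is onto, so pull-back along it is injective. The identity on generators
therefore both defines `ds_x` and determines it. Since `h^x` is the common zero space of the `β i`
(`mem_hCent_iff`), each formula amounts to evaluating `f` at a point where the `β i` vanish; there a
substituted monomial has the same value as the variable it replaces
(`evalAt_substMonomials_substMonomials`).

It remains to see that `[x, x] = 0`, which holds because `β i + β j` is not an even root
(`even_root_vector_eq_zero_of_isotropic`). An even root vector `y` of this weight would pair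
nontrivially with some even `f` of opposite weight, and `t = [y, f]` would be a nonzero multiple of
the vector of `h` dual to `β i + β j`. By orthogonality `β i` and `β j` vanish on `t`, so `ad t =
[ad y, ad f]` commutes with `ad y` and `ad f`. A trace argument shows that `ad t` has no nonzero
eigenvalue, so `t` is central. An invertible Cartan matrix leaves no nonzero central element in `h`;
in `gl(m|n)`, `t` is a scalar matrix of trace zero. Either way `t = 0`, a contradiction. -/

namespace SuperLie

open Module SuperSpace LieSuperalgebra LieSupermodule

/-! ### Simultaneous generalized eigenspaces of commuting linear families -/

section JointEigenspaces

variable {V V' N N' : Type*} [AddCommGroup V] [Module ℂ V] [AddCommGroup V'] [Module ℂ V']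
  [AddCommGroup N] [Module ℂ N] [AddCommGroup N'] [Module ℂ N']

/-- The simultaneous generalized eigenspace of a linear family of operators for the functional
`ν`. -/
def jointSpace (T : V →ₗ[ℂ] End ℂ N) (ν : Dual ℂ V) : Submodule ℂ N :=
  ⨅ t : V, (T t).maxGenEigenspace (ν t)

variable {T : V →ₗ[ℂ] End ℂ N} {T' : V →ₗ[ℂ] End ℂ N'}

theorem mem_jointSpace {ν : Dual ℂ V} {v : N} :
    v ∈ jointSpace T ν ↔ ∀ t, v ∈ (T t).maxGenEigenspace (ν t) := by
  simp [jointSpace, Submodule.mem_iInf]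

theorem mapsTo_maxGenEigenspace_of_commute (hT : ∀ s t, Commute (T s) (T t)) (s t : V) (c : ℂ) :
    Set.MapsTo (T s) ((T t).maxGenEigenspace c) ((T t).maxGenEigenspace c) :=
  End.mapsTo_maxGenEigenspace_of_comm (hT t s) c

theorem jointSpace_iSupIndep (hT : ∀ s t, Commute (T s) (T t)) : iSupIndep (jointSpace T) :=
  (End.independent_iInf_maxGenEigenspace_of_forall_mapsTo (fun t => T t)
    (mapsTo_maxGenEigenspace_of_commute hT)).comp
    (f := fun ν : Dual ℂ V => (ν : V → ℂ)) DFunLike.coe_injective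

/-- A simultaneous generalized eigenvalue of a commuting linear family is linear. -/
theorem exists_dual_eq_of_iInf_ne_bot [FiniteDimensional ℂ N] (hT : ∀ s t, Commute (T s) (T t))
    (χ : V → ℂ) (h : (⨅ t, (T t).maxGenEigenspace (χ t)) ≠ ⊥) : ∃ ν : Dual ℂ V, ⇑ν = χ := by
  set W : Submodule ℂ N := ⨅ t, (T t).maxGenEigenspace (χ t) with hW
  have hmaps : ∀ s, ∀ w ∈ W, T s w ∈ W := by
    intro s w hw
    rw [hW, Submodule.mem_iInf] at hw ⊢
    exact fun t => mapsTo_maxGenEigenspace_of_commute hT s t _ (hw t)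
  have hd : (finrank ℂ W : ℂ) ≠ 0 := by
    rw [Nat.cast_ne_zero, Ne, Submodule.finrank_eq_zero]
    exact h
  -- On `W` the operator `T t` is `χ t` plus a nilpotent, so `χ t` is its trace divided by `dim W`,
  -- and the trace is linear in `t`.
  have htr : ∀ t, LinearMap.trace ℂ W ((T t).restrict (hmaps t)) = χ t * finrank ℂ W := by
    intro t
    have hmaps' : ∀ w ∈ W, (T t - algebraMap ℂ (End ℂ N) (χ t)) w ∈ W := fun w hw => by
      simpa [Module.algebraMap_end_apply] using W.sub_mem (hmaps t w hw) (W.smul_mem (χ t) hw)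
    have hnil : IsNilpotent ((T t - algebraMap ℂ (End ℂ N) (χ t)).restrict hmaps') := by
      have hle : W ≤ (T t).maxGenEigenspace (χ t) :=
        iInf_le (fun t => (T t).maxGenEigenspace (χ t)) t
      exact Module.End.isNilpotent_restrict_of_le hle
        (End.isNilpotent_restrict_maxGenEigenspace_sub_algebraMap (T t) (χ t))
    have htr0 := (LinearMap.isNilpotent_trace_of_isNilpotent hnil).eq_zero
    have hdec : (T t).restrict (hmaps t) =
        (T t - algebraMap ℂ (End ℂ N) (χ t)).restrict hmaps' + χ t • LinearMap.id := by
      ext w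
      simp [Module.algebraMap_end_apply]
    rw [hdec, map_add, htr0, map_smul, LinearMap.trace_id, zero_add, smul_eq_mul]
  refine ⟨{ toFun := χ, map_add' := fun s t => ?_, map_smul' := fun c t => ?_ }, rfl⟩
  · apply mul_right_cancel₀ hd
    rw [add_mul, ← htr, ← htr, ← htr, ← map_add]
    congr 1
    ext w
    simp
  · apply mul_right_cancel₀ hd
    rw [RingHom.id_apply, smul_eq_mul, mul_assoc, ← htr, ← htr, ← smul_eq_mul, ← map_smul]
    congr 1
    ext w
    simp

/-- The general decomposition runs over all functions `V → ℂ`; those that are not linear contribute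
only zero. -/
theorem iSup_jointSpace [FiniteDimensional ℂ N] (hT : ∀ s t, Commute (T s) (T t)) :
    ⨆ ν, jointSpace T ν = ⊤ := by
  have h := End.iSup_iInf_maxGenEigenspace_eq_top_of_forall_mapsTo (fun t => T t)
    (mapsTo_maxGenEigenspace_of_commute hT) (fun t => End.iSup_maxGenEigenspace_eq_top (T t))
  rw [eq_top_iff, ← h]
  refine iSup_le fun χ => ?_
  by_cases hχ : (⨅ t, (T t).maxGenEigenspace (χ t)) = ⊥
  · rw [hχ]
    exact bot_le
  · obtain ⟨ν, rfl⟩ := exists_dual_eq_of_iInf_ne_bot hT χ hχ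
    exact le_iSup (jointSpace T) ν

theorem finite_jointSpace_ne_bot [FiniteDimensional ℂ N] (hT : ∀ s t, Commute (T s) (T t)) :
    {ν | jointSpace T ν ≠ ⊥}.Finite :=
  WellFoundedGT.finite_ne_bot_of_iSupIndep (jointSpace_iSupIndep hT)

theorem map_mem_jointSpace {f : N →ₗ[ℂ] N'} (hf : ∀ t n, f (T t n) = T' t (f n))
    {ν : Dual ℂ V} {v : N} (hv : v ∈ jointSpace T ν) : f v ∈ jointSpace T' ν := by
  rw [mem_jointSpace] at hv ⊢
  intro t
  have hpow : ∀ (k : ℕ) (n : N), f (((T t - ν t • (1 : End ℂ N)) ^ k) n) =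
      ((T' t - ν t • (1 : End ℂ N')) ^ k) (f n) := by
    intro k
    induction k with
    | zero => simp
    | succ k ih =>
      intro n
      rw [pow_succ, pow_succ, Module.End.mul_apply, Module.End.mul_apply, ih]
      simp [hf]
  obtain ⟨k, hk⟩ := (End.mem_maxGenEigenspace _ _ _).1 (hv t)
  exact (End.mem_maxGenEigenspace _ _ _).2 ⟨k, by rw [← hpow, hk, map_zero]⟩

/-- If `f` maps each summand of a decomposition into a member of an independent family, then the
part of `range f` inside one member is the image of the summands mapped into it. -/
theorem mem_of_mem_of_iSupIndep {ι κ : Type*} {G : ι → Submodule ℂ N} (hG : ⨆ i, G i = ⊤)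
    {G' : κ → Submodule ℂ N'} (hG' : iSupIndep G') (f : N →ₗ[ℂ] N') (g : ι → κ)
    (hfg : ∀ i, (G i).map f ≤ G' (g i)) (j : κ) {v : N} (hv : f v ∈ G' j) :
    f v ∈ (⨆ (i) (_ : g i = j), G i).map f := by
  have hsplit : v ∈ (⨆ (i) (_ : g i = j), G i) ⊔ ⨆ (i) (_ : g i ≠ j), G i := by
    have : (⨆ (i) (_ : g i = j), G i) ⊔ (⨆ (i) (_ : g i ≠ j), G i) = ⊤ := by
      rw [eq_top_iff, ← hG]
      refine iSup_le fun i => ?_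
      by_cases hi : g i = j
      · exact le_sup_of_le_left (le_iSup₂_of_le i hi le_rfl)
      · exact le_sup_of_le_right (le_iSup₂_of_le i hi le_rfl)
    rw [this]
    trivial
  obtain ⟨a, ha, b, hb, rfl⟩ := Submodule.mem_sup.1 hsplit
  have hfa : f a ∈ G' j := by
    have hle : (⨆ (i) (_ : g i = j), G i) ≤ (G' j).comap f :=
      iSup₂_le fun i hi => Submodule.map_le_iff_le_comap.1 (hi ▸ hfg i)
    exact hle ha
  -- The rest `b` maps into the other members, but also into `G' j` by subtraction, so independence
  -- gives `f b = 0`.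
  have hfb : f b ∈ ⨆ (k) (_ : k ≠ j), G' k := by
    have hle : (⨆ (i) (_ : g i ≠ j), G i) ≤ (⨆ (k) (_ : k ≠ j), G' k).comap f :=
      iSup₂_le fun i hi => Submodule.map_le_iff_le_comap.1
        ((hfg i).trans (le_iSup₂_of_le (g i) hi le_rfl))
    exact hle hb
  have hfb' : f b ∈ G' j := by
    have := (G' j).sub_mem hv hfa
    rwa [map_add, add_sub_cancel_left] at this
  rw [map_add, Submodule.disjoint_def.1 (hG' j) _ hfb' hfb, add_zero]
  exact Submodule.mem_map_of_mem ha

/-- Passing to a generalized eigenspace is exact: a vector of the image lying in one eigenspace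
lifts to the same eigenspace, because the source decomposes and the target eigenspaces are
independent. -/
theorem map_jointSpace [FiniteDimensional ℂ N] (hT : ∀ s t, Commute (T s) (T t))
    (hT' : ∀ s t, Commute (T' s) (T' t)) (f : N →ₗ[ℂ] N')
    (hf : ∀ t n, f (T t n) = T' t (f n)) (ν : Dual ℂ V) :
    (jointSpace T ν).map f = jointSpace T' ν ⊓ LinearMap.range f := by
  apply le_antisymm
  · rintro _ ⟨v, hv, rfl⟩
    exact ⟨map_mem_jointSpace hf hv, v, rfl⟩
  · rintro _ ⟨hv, v, rfl⟩
    have := mem_of_mem_of_iSupIndep (iSup_jointSpace hT) (jointSpace_iSupIndep hT') f id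
      (by rintro μ _ ⟨w, hw, rfl⟩; exact map_mem_jointSpace hf hw) ν hv
    simpa only [id, iSup_iSup_eq_left] using this

/-- The restriction of a linear family of operators to a stable subspace. -/
def restrictFamily (T : V →ₗ[ℂ] End ℂ N) (P : Submodule ℂ N) (hP : ∀ t, ∀ v ∈ P, T t v ∈ P) :
    V →ₗ[ℂ] End ℂ P where
  toFun t := (T t).restrict (hP t)
  map_add' s t := by ext v; simp
  map_smul' c t := by ext v; simp

theorem restrictFamily_commute {P : Submodule ℂ N} (hP : ∀ t, ∀ v ∈ P, T t v ∈ P)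
    (hT : ∀ s t, Commute (T s) (T t)) (s t : V) :
    Commute (restrictFamily T P hP s) (restrictFamily T P hP t) := by
  ext v
  exact LinearMap.congr_fun (hT s t) (v : N)

theorem map_subtype_jointSpace [FiniteDimensional ℂ N] (hT : ∀ s t, Commute (T s) (T t))
    {P : Submodule ℂ N} (hP : ∀ t, ∀ v ∈ P, T t v ∈ P) (ν : Dual ℂ V) :
    (jointSpace (restrictFamily T P hP) ν).map P.subtype = jointSpace T ν ⊓ P := by
  rw [map_jointSpace (restrictFamily_commute hP hT) hT P.subtype (fun _ _ => rfl),
    Submodule.range_subtype]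

theorem map_jointSpace_inf [FiniteDimensional ℂ N] (hT : ∀ s t, Commute (T s) (T t))
    (hT' : ∀ s t, Commute (T' s) (T' t)) (f : N →ₗ[ℂ] N')
    (hf : ∀ t n, f (T t n) = T' t (f n)) {P : Submodule ℂ N} (hP : ∀ t, ∀ v ∈ P, T t v ∈ P)
    (ν : Dual ℂ V) : (jointSpace T ν ⊓ P).map f = jointSpace T' ν ⊓ P.map f := by
  rw [← map_subtype_jointSpace hT hP, ← Submodule.map_comp,
    map_jointSpace (restrictFamily_commute hP hT) hT' (f ∘ₗ P.subtype) (fun t v => hf t v),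
    LinearMap.range_comp, Submodule.range_subtype]

theorem finrank_map_of_injective {f : N →ₗ[ℂ] N'} (hf : Function.Injective f)
    (p : Submodule ℂ N) : finrank ℂ (p.map f) = finrank ℂ p :=
  (LinearEquiv.finrank_eq (Submodule.equivMapOfInjective f hf p)).symm

/-- The dimension of the part of a simultaneous generalized eigenspace inside `P`. -/
noncomputable def jointDim (T : V →ₗ[ℂ] End ℂ N) (P : Submodule ℂ N) (ν : Dual ℂ V) : ℕ :=
  finrank ℂ ↥(jointSpace T ν ⊓ P)

/-- Rank–nullity for `f` on the `ν`-part of `P`; exactness identifies the image with the full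
`ν`-part of `P.map f`. -/
theorem jointDim_eq_map_add_ker [FiniteDimensional ℂ N] (hT : ∀ s t, Commute (T s) (T t))
    (hT' : ∀ s t, Commute (T' s) (T' t)) (f : N →ₗ[ℂ] N')
    (hf : ∀ t n, f (T t n) = T' t (f n)) {P : Submodule ℂ N} (hP : ∀ t, ∀ v ∈ P, T t v ∈ P)
    (ν : Dual ℂ V) :
    jointDim T P ν = jointDim T' (P.map f) ν + jointDim T (P ⊓ LinearMap.ker f) ν := by
  have h := (f.domRestrict (jointSpace T ν ⊓ P)).finrank_range_add_finrank_ker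
  rw [LinearMap.range_domRestrict, map_jointSpace_inf hT hT' f hf hP, LinearMap.ker_domRestrict]
    at h
  rw [jointDim, jointDim, jointDim, ← h, ← inf_assoc]
  congr 1
  rw [← finrank_map_of_injective (jointSpace T ν ⊓ P).injective_subtype,
    Submodule.map_comap_subtype]

theorem finrank_biSup_of_iSupIndep {ι : Type*} [FiniteDimensional ℂ N] {G : ι → Submodule ℂ N}
    (hG : iSupIndep G) (s : Finset ι) :
    finrank ℂ ↥(⨆ i ∈ s, G i) = ∑ i ∈ s, finrank ℂ (G i) := by
  classical
  induction s using Finset.induction_on with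
  | empty => simp
  | insert i s hi ih =>
    have hd : G i ⊓ ⨆ j ∈ s, G j = ⊥ :=
      (hG.disjoint_biSup (y := (s : Set ι)) (by simpa using hi)).eq_bot
    rw [Finset.iSup_insert, Finset.sum_insert hi, ← ih, ← Submodule.finrank_sup_add_finrank_inf_eq,
      hd, finrank_bot, add_zero]

theorem jointSpace_le_comp (φ : V' →ₗ[ℂ] V) (μ : Dual ℂ V) :
    jointSpace T μ ≤ jointSpace (T ∘ₗ φ) (φ.dualMap μ) := by
  intro v hv
  rw [mem_jointSpace] at hv ⊢
  exact fun t => hv (φ t)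

/-- Apply `mem_of_mem_of_iSupIndep` to the identity map, between the decompositions for `T` and for
`T ∘ₗ φ`. -/
theorem jointSpace_comp [FiniteDimensional ℂ N] (hT : ∀ s t, Commute (T s) (T t))
    (φ : V' →ₗ[ℂ] V) (ν : Dual ℂ V') :
    jointSpace (T ∘ₗ φ) ν = ⨆ (μ) (_ : φ.dualMap μ = ν), jointSpace T μ := by
  apply le_antisymm
  · intro v hv
    have := mem_of_mem_of_iSupIndep (iSup_jointSpace hT)
      (jointSpace_iSupIndep (T := T ∘ₗ φ) fun s t => hT _ _) LinearMap.id φ.dualMap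
      (fun μ => by simpa using jointSpace_le_comp φ μ) ν hv
    rwa [Submodule.map_id] at this
  · refine iSup₂_le fun μ hμ => ?_
    subst hμ
    exact jointSpace_le_comp φ μ

/-- The fibre of `φ.dualMap` may be infinite; `S` is any finite set containing all the occurring
eigenvalues, which makes the sum meaningful. -/
theorem finrank_jointSpace_comp [FiniteDimensional ℂ N] (hT : ∀ s t, Commute (T s) (T t))
    (φ : V' →ₗ[ℂ] V) (ν : Dual ℂ V') [DecidableEq (Dual ℂ V')] (S : Finset (Dual ℂ V))
    (hS : ∀ μ, jointSpace T μ ≠ ⊥ → μ ∈ S) :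
    finrank ℂ (jointSpace (T ∘ₗ φ) ν) =
      ∑ μ ∈ S with φ.dualMap μ = ν, finrank ℂ (jointSpace T μ) := by
  have hsup : (⨆ (μ) (_ : φ.dualMap μ = ν), jointSpace T μ) =
      ⨆ μ ∈ S.filter (fun μ => φ.dualMap μ = ν), jointSpace T μ := by
    apply le_antisymm
    · refine iSup₂_le fun μ hμ => ?_
      by_cases h : jointSpace T μ = ⊥
      · rw [h]
        exact bot_le
      · exact le_iSup₂_of_le (f := fun μ _ => jointSpace T μ) μ
          (Finset.mem_filter.2 ⟨hS μ h, hμ⟩) le_rfl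
    · exact iSup₂_le fun μ hμ => le_iSup₂_of_le (f := fun μ _ => jointSpace T μ) μ
        (Finset.mem_filter.1 hμ).2 le_rfl
  rw [← finrank_biSup_of_iSupIndep (jointSpace_iSupIndep hT), jointSpace_comp hT, hsup]

theorem jointDim_comp [FiniteDimensional ℂ N] (hT : ∀ s t, Commute (T s) (T t))
    {P : Submodule ℂ N} (hP : ∀ t, ∀ v ∈ P, T t v ∈ P)
    (φ : V' →ₗ[ℂ] V) (ν : Dual ℂ V') [DecidableEq (Dual ℂ V')] (S : Finset (Dual ℂ V))
    (hS : ∀ μ, jointSpace T μ ≠ ⊥ → μ ∈ S) :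
    jointDim (T ∘ₗ φ) P ν = ∑ μ ∈ S with φ.dualMap μ = ν, jointDim T P μ := by
  have hfr : ∀ μ, jointDim T P μ = finrank ℂ (jointSpace (restrictFamily T P hP) μ) := fun μ => by
    rw [jointDim, ← map_subtype_jointSpace hT hP]
    exact finrank_map_of_injective P.injective_subtype _
  have hfr' : jointDim (T ∘ₗ φ) P ν =
      finrank ℂ (jointSpace (restrictFamily T P hP ∘ₗ φ) ν) := by
    rw [jointDim, ← map_subtype_jointSpace (T := T ∘ₗ φ) (fun s t => hT _ _)
      (fun t v hv => hP _ v hv)]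
    exact finrank_map_of_injective P.injective_subtype _
  rw [hfr', finrank_jointSpace_comp (restrictFamily_commute hP hT) φ ν S]
  · exact Finset.sum_congr rfl fun μ _ => (hfr μ).symm
  · intro μ hμ
    refine hS μ fun hbot => hμ ?_
    have := map_subtype_jointSpace hT hP μ
    rw [hbot, bot_inf_eq] at this
    exact Submodule.map_injective_of_injective P.injective_subtype
      (this.trans (Submodule.map_bot _).symm)

end JointEigenspaces

/-! ### Orthogonal isotropic roots, `[x, x] = 0` and the centralizer `h^x` -/

section IsotropicRoots

variable {L : Type*} [AddCommGroup L] [Module ℂ L] [LieSuperalgebra L] {H : EvenAbelian L}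

theorem superSign_zero_left (j : ZMod 2) : superSign 0 j = 1 := by
  simp [superSign]

theorem superSign_zero_right (i : ZMod 2) : superSign i 0 = 1 := by
  simp [superSign]

/-- Even elements act on `L` by derivations. -/
theorem bracket_even_bracket {a : L} (ha : a ∈ part (V := L) 0) (b c : L) :
    bracket a (bracket b c) = bracket (bracket a b) c + bracket b (bracket a c) := by
  obtain ⟨b0, h0, b1, h1, rfl⟩ := exists_decomp b
  have e0 := bracket_jacobi c ha h0
  have e1 := bracket_jacobi c ha h1
  rw [superSign_zero_left, one_smul] at e0 e1
  simp only [map_add, LinearMap.add_apply, e0, e1]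
  abel

theorem bracket_even_comm {a : L} (ha : a ∈ part (V := L) 0) (b : L) :
    bracket b a = -bracket a b := by
  obtain ⟨b0, h0, b1, h1, rfl⟩ := exists_decomp b
  have e0 := bracket_skew h0 ha
  have e1 := bracket_skew h1 ha
  rw [superSign_zero_right, one_smul] at e0 e1
  simp only [map_add, LinearMap.add_apply, e0, e1]
  abel

theorem bracket_mem_rootSpace {α β : H.Weight} {a b : L} (ha : a ∈ rootSpace H α)
    (hb : b ∈ rootSpace H β) : bracket a b ∈ rootSpace H (α + β) := by
  intro t
  rw [bracket_even_bracket (H.le_even t.2), ha t, hb t, LinearMap.add_apply, add_smul]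
  simp

theorem rootSpace_even_component {α : H.Weight} {a b : L} (ha : a ∈ part (V := L) 0)
    (hb : b ∈ part (V := L) 1) (h : a + b ∈ rootSpace H α) : a ∈ rootSpace H α := by
  intro t
  have ht := h t
  have h0 : bracket (t : L) a ∈ part (V := L) 0 := by
    simpa using bracket_mem (H.le_even t.2) ha
  have h1 : bracket (t : L) b ∈ part (V := L) 1 := by
    simpa using bracket_mem (H.le_even t.2) hb
  refine sub_eq_zero.1 (eq_zero_of_add_eq_zero
    ((part (V := L) 0).sub_mem h0 ((part (V := L) 0).smul_mem (α t) ha))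
    ((part (V := L) 1).sub_mem h1 ((part (V := L) 1).smul_mem (α t) hb)) ?_).1
  rw [sub_add_sub_comm, ← map_add, ht, smul_add, sub_self]

theorem form_bracket_left (Φ : InvariantForm L) {t : L} (ht : t ∈ part (V := L) 0) (a b : L) :
    Φ.form (bracket t a) b = -Φ.form a (bracket t b) := by
  rw [← neg_eq_iff_eq_neg, ← LinearMap.neg_apply, ← map_neg, ← bracket_even_comm ht, Φ.invariant]

theorem form_comm_of_even (Φ : InvariantForm L) {a b : L} (ha : a ∈ part (V := L) 0)
    (hb : b ∈ part (V := L) 0) : Φ.form a b = Φ.form b a := by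
  rw [Φ.supersymm ha hb, superSign_zero_left, one_mul]

/-- An even root vector pairs nontrivially with an even vector of the opposite root. -/
theorem exists_even_dual_root_vector (hH : H.IsCartan) (Φ : InvariantForm L) {γ : H.Weight}
    {y : L} (hy : y ∈ rootSpace H γ) (hy0 : y ∈ part (V := L) 0) (hne : y ≠ 0) :
    ∃ f ∈ rootSpace H (-γ), f ∈ part (V := L) 0 ∧ Φ.form y f ≠ 0 := by
  obtain ⟨α, f, hf, hyf⟩ : ∃ α : H.Weight, ∃ f ∈ rootSpace H α, Φ.form y f ≠ 0 := by
    by_contra! hcon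
    apply hne
    refine Φ.nondegenerate.1 y fun f => ?_
    have hle : ⨆ α : H.Weight, rootSpace H α ≤ LinearMap.ker (Φ.form y) :=
      iSup_le fun α f hf => hcon α f hf
    rw [hH.iSup_rootSpace] at hle
    exact hle (Submodule.mem_top (x := f))
  -- Invariance under `h` gives `γ(t) (y, f) = -α(t) (y, f)`, and `(y, f) ≠ 0`.
  have hα : α = -γ := by
    ext t
    have h := form_bracket_left Φ (H.le_even t.2) y f
    rw [hy t, hf t, map_smul, LinearMap.smul_apply, map_smul, smul_eq_mul, smul_eq_mul,
      ← neg_mul] at h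
    rw [LinearMap.neg_apply, mul_right_cancel₀ hyf h, neg_neg]
  subst hα
  obtain ⟨f0, h0, f1, h1, rfl⟩ := exists_decomp f
  refine ⟨f0, rootSpace_even_component h0 h1 hf, h0, ?_⟩
  rwa [map_add, Φ.even hy0 h1 (by decide), add_zero] at hyf

/-- A commutator of two operators that commutes with both has no nonzero eigenvalue. -/
theorem eq_zero_of_commutator_of_commute {N : Type*} [AddCommGroup N] [Module ℂ N]
    [FiniteDimensional ℂ N] (Y F : End ℂ N) (hY : Commute (Y * F - F * Y) Y)
    (hF : Commute (Y * F - F * Y) F) {c : ℂ} (hc : c ≠ 0) {v : N}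
    (hv : (Y * F - F * Y) v = c • v) : v = 0 := by
  set D := Y * F - F * Y
  have hYm : ∀ w ∈ D.eigenspace c, Y w ∈ D.eigenspace c := fun w hw => by
    rw [End.mem_eigenspace_iff] at hw ⊢
    rw [← Module.End.mul_apply, hY.eq, Module.End.mul_apply, hw, map_smul]
  have hFm : ∀ w ∈ D.eigenspace c, F w ∈ D.eigenspace c := fun w hw => by
    rw [End.mem_eigenspace_iff] at hw ⊢
    rw [← Module.End.mul_apply, hF.eq, Module.End.mul_apply, hw, map_smul]
  have hcomm : Y.restrict hYm * F.restrict hFm - F.restrict hFm * Y.restrict hYm =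
      c • LinearMap.id := by
    ext w
    exact End.mem_eigenspace_iff.1 w.2
  have htr := congrArg (LinearMap.trace ℂ _) hcomm
  -- On the `c`-eigenspace of `D`, stable under `Y` and `F`, the commutator is the scalar `c`. Its
  -- trace is zero, so `c` times the dimension vanishes.
  rw [map_sub, LinearMap.trace_mul_comm, sub_self, map_smul, LinearMap.trace_id, smul_eq_mul,
    eq_comm, mul_eq_zero, or_iff_right hc, Nat.cast_eq_zero, Submodule.finrank_eq_zero] at htr
  have : v ∈ D.eigenspace c := End.mem_eigenspace_iff.2 hv
  rwa [htr, Submodule.mem_bot] at this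

/-- Centrality forces every simple root to vanish on `t`, since `e i ≠ 0`. An invertible Cartan
matrix makes `dim h` equal to the number of simple roots, so these span the dual of `h`. -/
theorem eq_zero_of_central_of_isContragredient [FiniteDimensional ℂ L] {ι : Type} [Fintype ι] [DecidableEq ι]
    {A : Matrix ι ι ℂ} {p : ι → ZMod 2} (hA : IsUnit A.det) (h : IsContragredient H A p)
    (t : H.carrier) (ht : ∀ a : L, bracket (t : L) a = 0) : t = 0 := by
  obtain ⟨hh, α, e, f, hhh, hα, hdim, -, -, hef, hbr, -, -⟩ := h
  have hrank : A.rank = Fintype.card ι :=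
    Matrix.rank_of_isUnit A ((Matrix.isUnit_iff_isUnit_det A).2 hA)
  have hαt : ∀ i, α i t = 0 := by
    intro i
    have he : e i ≠ 0 := by
      intro h0
      have := hbr i i
      rw [h0, map_zero, LinearMap.zero_apply, if_pos rfl] at this
      exact hhh.ne_zero i (Subtype.ext this.symm)
    have := (hef i).1 t
    rw [ht, eq_comm, smul_eq_zero, or_iff_left he] at this
    exact this
  have hspan : Submodule.span ℂ (Set.range α) = ⊤ := by
    refine hα.span_eq_top_of_card_eq_finrank' ?_
    rw [Subspace.dual_finrank_eq]
    omega
  have hle : Submodule.span ℂ (Set.range α) ≤ LinearMap.ker (Dual.eval ℂ H.carrier t) :=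
    Submodule.span_le.2 (by rintro _ ⟨i, rfl⟩; exact hαt i)
  rw [hspan] at hle
  exact (forall_dual_apply_eq_zero_iff ℂ t).1 fun μ => hle (Submodule.mem_top (x := μ))

/-- Commuting with the matrix units makes the diagonal matrix of `t` scalar. As a bracket of even
elements it is an ordinary commutator, so its ordinary trace vanishes, not merely its supertrace;
this excludes the identity even when `m = n`. -/
theorem eq_zero_of_central_of_isGL {m n : ℕ} (h : IsGL H m n) (t : H.carrier)
    (ht : ∀ a : L, bracket (t : L) a = 0) {y f : L} (hy : y ∈ part (V := L) 0)
    (hf : f ∈ part (V := L) 0) (htyf : (t : L) = bracket y f) : t = 0 := by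
  obtain ⟨φ, hpart, hbr, hdiag⟩ := h
  have htr : (φ t).trace = 0 := by
    rw [htyf, hbr 0 0 y f hy hf, superSign_zero_left, one_smul, Matrix.trace_sub,
      Matrix.trace_mul_comm, sub_self]
  have hconst : ∀ r s, φ t r r = φ t s s := by
    intro r s
    set E : Matrix (Fin m ⊕ Fin n) (Fin m ⊕ Fin n) ℂ := Matrix.single r s 1 with hE
    have hEp : φ.symm E ∈ part (V := L) (idxParity r + idxParity s) := by
      rw [hpart]
      intro r' s' hne
      rw [LinearEquiv.apply_symm_apply, hE, Matrix.single_apply, if_neg]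
      rintro ⟨rfl, rfl⟩
      exact hne rfl
    have h := hbr _ _ _ _ (H.le_even t.2) hEp
    rw [ht, map_zero, superSign_zero_left, one_smul, LinearEquiv.apply_symm_apply] at h
    have := congrFun (congrFun h r) s
    simp [hE, Matrix.sub_apply] at this
    exact sub_eq_zero.1 this.symm
  have hd := (hdiag t).1 t.2
  apply Subtype.ext
  apply φ.injective
  rw [ZeroMemClass.coe_zero, map_zero]
  ext r s
  by_cases hrs : r = s
  · subst hrs
    rw [Matrix.trace, Finset.sum_congr rfl fun s _ => (show (φ t).diag s = φ t r r from hconst s r),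
      Finset.sum_const, smul_eq_zero] at htr
    refine htr.resolve_left ?_
    exact Finset.card_ne_zero_of_mem (Finset.mem_univ r)
  · exact hd hrs

/-- `Orthogonal` only provides some pair of representing vectors; symmetry of the form on `h`
transfers the vanishing to any given representative of `α`. -/
theorem orthogonal_apply_eq_zero {Φ : InvariantForm L} {α β : H.Weight}
    (h : Φ.Orthogonal H α β) {s : H.carrier} (hs : Φ.Represents H s α) : β s = 0 := by
  obtain ⟨u, v, hu, hv, huv⟩ := h
  rw [← hv s, form_comm_of_even Φ (H.le_even v.2) (H.le_even s.2), hs v, ← hu v, huv]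

/-- The sum of two orthogonal isotropic functionals is not an even root. -/
theorem even_root_vector_eq_zero_of_isotropic [FiniteDimensional ℂ L] (hH : H.IsCartan)
    (hL : IsContragredientOrGL H) (Φ : InvariantForm L) {α β : H.Weight}
    (hαα : Φ.Orthogonal H α α) (hββ : Φ.Orthogonal H β β) (hαβ : Φ.Orthogonal H α β)
    (hne : α + β ≠ 0) {y : L} (hy : y ∈ rootSpace H (α + β)) (hy0 : y ∈ part (V := L) 0) :
    y = 0 := by
  by_contra hyne
  obtain ⟨f, hf, hf0, hyf⟩ := exists_even_dual_root_vector hH Φ hy hy0 hyne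
  have hmem : bracket y f ∈ H.carrier := by
    rw [← hH.rootSpace_zero, ← add_neg_cancel (α + β)]
    exact bracket_mem_rootSpace hy hf
  obtain ⟨t, ht⟩ : ∃ t : H.carrier, (t : L) = bracket y f := ⟨⟨_, hmem⟩, rfl⟩
  -- Thus `t` is `(y, f)` times the vector dual to `α + β`.
  have hrep : ∀ s : H.carrier, Φ.form (t : L) (s : L) = (α + β) s * Φ.form y f := by
    intro s
    rw [ht, Φ.invariant, bracket_even_comm (H.le_even s.2), hf s, LinearMap.neg_apply, neg_smul,
      neg_neg, map_smul, smul_eq_mul]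
  have hval : ∀ {δ : H.Weight} {s : H.carrier}, Φ.Represents H s δ → (α + β) s = 0 → δ t = 0 := by
    intro δ s hs h0
    rw [← hs t, form_comm_of_even Φ (H.le_even s.2) (H.le_even t.2), hrep, h0, zero_mul]
  have hβα : Φ.Orthogonal H β α := by
    obtain ⟨u, v, hu, hv, huv⟩ := hαβ
    exact ⟨v, u, hv, hu, by rwa [form_comm_of_even Φ (H.le_even v.2) (H.le_even u.2)]⟩
  have hαt : α t = 0 := by
    have ⟨s, _, hs, _, _⟩ := hαβ
    refine hval hs ?_
    rw [LinearMap.add_apply, orthogonal_apply_eq_zero hαα hs, orthogonal_apply_eq_zero hαβ hs,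
      add_zero]
  have hβt : β t = 0 := by
    have ⟨_, s, _, hs, _⟩ := hαβ
    refine hval hs ?_
    rw [LinearMap.add_apply, orthogonal_apply_eq_zero hββ hs, orthogonal_apply_eq_zero hβα hs,
      add_zero]
  have had : bracket (t : L) = (bracket y * bracket f - bracket f * bracket y : End ℂ L) := by
    ext a
    rw [ht, LinearMap.sub_apply, Module.End.mul_apply, Module.End.mul_apply,
      bracket_even_bracket hy0]
    abel
  have hcomm : ∀ {δ : H.Weight} {z : L}, z ∈ rootSpace H δ → δ t = 0 →
      Commute (bracket (t : L) : End ℂ L) (bracket z) := by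
    intro δ z hz h0
    ext a
    rw [Module.End.mul_apply, Module.End.mul_apply, bracket_even_bracket (H.le_even t.2), hz t, h0,
      zero_smul, map_zero, LinearMap.zero_apply, zero_add]
  have hγt : (α + β) t = 0 := by rw [LinearMap.add_apply, hαt, hβt, add_zero]
  -- A root vector of weight `δ` is an eigenvector of `ad t = [ad y, ad f]` with eigenvalue `δ t`,
  -- so the trace argument rules out `δ t ≠ 0`.
  have hcent : ∀ a : L, bracket (t : L) a = 0 := by
    have hle : ⨆ δ : H.Weight, rootSpace H δ ≤ LinearMap.ker (bracket (t : L)) := by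
      refine iSup_le fun δ a ha => ?_
      rw [LinearMap.mem_ker, ha t]
      by_cases h0 : δ t = 0
      · rw [h0, zero_smul]
      · have hYc := hcomm hy hγt
        have hFc := hcomm hf (by rw [LinearMap.neg_apply, hγt, neg_zero])
        have hat := ha t
        rw [had] at hYc hFc hat
        rw [eq_zero_of_commutator_of_commute _ _ hYc hFc h0 hat, smul_zero]
    rw [hH.iSup_rootSpace] at hle
    exact fun a => hle (Submodule.mem_top (x := a))
  have ht0 : t = 0 := by
    rcases hL with ⟨m, n, h⟩ | ⟨ι, _, _, A, p, -, hA, h⟩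
    · exact eq_zero_of_central_of_isGL h t hcent hy0 hf0 ht
    · exact eq_zero_of_central_of_isContragredient hA h t hcent
  -- With `t = 0`, the formula `hrep` and `(y, f) ≠ 0` force `α + β = 0`.
  apply hne
  ext s
  have := hrep s
  rw [ht0, ZeroMemClass.coe_zero, map_zero, LinearMap.zero_apply, eq_comm, mul_eq_zero,
    or_iff_left hyf] at this
  exact this

/-- Expand bilinearly: each `[xβ i, xβ j]` is an even vector of weight `β i + β j`. This weight is
nonzero, as `2 β i ≠ 0` on the diagonal and `β i ≠ -β j` off it. -/
theorem bracket_self_eq_zero_of_isIsotropicSet [FiniteDimensional ℂ L] (hH : H.IsCartan)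
    (hL : IsContragredientOrGL H) (Φ : InvariantForm L) {k : ℕ} {β : Fin k → H.Weight}
    (hβ : IsIsotropicSet Φ H β) {xβ : Fin k → L} (hxβ : ∀ i, xβ i ∈ rootSpace H (β i)) :
    bracket (∑ i, xβ i) (∑ i, xβ i) = 0 := by
  have hij : ∀ i j, bracket (xβ i) (xβ j) = 0 := by
    intro i j
    refine even_root_vector_eq_zero_of_isotropic hH hL Φ (hβ.orthogonal i i) (hβ.orthogonal j j)
      (hβ.orthogonal i j) ?_ (bracket_mem_rootSpace (hxβ i) (hxβ j))
      (bracket_mem ((hβ.odd_root i).2.2 (hxβ i)) ((hβ.odd_root j).2.2 (hxβ j)))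
    intro h
    by_cases hij : i = j
    · subst hij
      rw [← two_smul ℂ, smul_eq_zero, or_iff_right two_ne_zero] at h
      exact (hβ.odd_root i).1 h
    · exact (hβ.ne i j hij).2 (eq_neg_of_add_eq_zero_left h)
  simp only [map_sum, LinearMap.sum_apply, hij, Finset.sum_const_zero]

/-- Root spaces lie inside the simultaneous generalized eigenspaces of the adjoint action, which are
independent. -/
theorem rootSpace_iSupIndep (H : EvenAbelian L) : iSupIndep (rootSpace H) := by
  have h := (End.independent_iInf_maxGenEigenspace_of_forall_mapsTo
    (fun t : H.carrier => (act (t : L) : End ℂ L))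
    (fun s t φ => End.mapsTo_maxGenEigenspace_of_comm (act_commute H L t s) φ)).comp
    (f := fun ν : H.Weight => (ν : H.carrier → ℂ)) DFunLike.coe_injective
  refine h.mono fun α a ha => ?_
  refine (Submodule.mem_iInf _).2 fun t => (End.mem_maxGenEigenspace _ _ _).2 ⟨1, ?_⟩
  rw [pow_one, LinearMap.sub_apply]
  exact sub_eq_zero.2 (ha t)

/-- The centralizer of `x` in `h` is cut out by the roots in the support of `x`. -/
theorem mem_hCent_iff {k : ℕ} {β : Fin k → H.Weight} (hβ : Function.Injective β) {xβ : Fin k → L}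
    (hxβ : ∀ i, xβ i ∈ rootSpace H (β i)) (hxβ0 : ∀ i, xβ i ≠ 0) {x : OddPart L}
    (hx : (x : L) = ∑ i, xβ i) (t : H.carrier) : t ∈ hCent H x ↔ ∀ i, β i t = 0 := by
  have hli : LinearIndependent ℂ xβ :=
    ((rootSpace_iSupIndep H).comp hβ).linearIndependent _ hxβ hxβ0
  have hmem : t ∈ hCent H x ↔ ∑ i, β i t • xβ i = 0 := by
    change (t : L) ∈ kerx x L ↔ _
    rw [mem_kerx]
    change bracket (x : L) (t : L) = 0 ↔ _
    rw [bracket_even_comm (H.le_even t.2), neg_eq_zero, hx, map_sum,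
      Finset.sum_congr rfl fun i _ => hxβ i t]
  rw [hmem]
  refine ⟨fun h => Fintype.linearIndependent_iff.1 hli _ h, fun h => ?_⟩
  exact Finset.sum_eq_zero fun i _ => by rw [h i, zero_smul]

end IsotropicRoots

/-! ### Pull-back, evaluation and substitution for exponential sums -/

section ExponentialSums

variable {V W U : Type*} [AddCommGroup V] [Module ℂ V] [AddCommGroup W] [Module ℂ W]
  [AddCommGroup U] [Module ℂ U]

theorem coeff_pullbackExp (φ : V →ₗ[ℂ] W) (f : AddMonoidAlgebra ℤ (Dual ℂ W)) :
    (pullbackExp φ f).coeff = f.coeff.mapDomain φ.dualMap := rfl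

theorem pullbackExp_comp (φ : V →ₗ[ℂ] W) (ψ : W →ₗ[ℂ] U) (f : AddMonoidAlgebra ℤ (Dual ℂ U)) :
    pullbackExp (ψ ∘ₗ φ) f = pullbackExp φ (pullbackExp ψ f) := by
  apply AddMonoidAlgebra.coeff_injective
  rw [coeff_pullbackExp, coeff_pullbackExp, coeff_pullbackExp, ← Finsupp.mapDomain_comp]
  rfl

/-- The dual of a surjection is injective, so distinct exponents stay distinct. This lets identities
on `h^x` descend to `h_x`. -/
theorem pullbackExp_injective {φ : V →ₗ[ℂ] W} (hφ : Function.Surjective φ) :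
    Function.Injective (pullbackExp φ) :=
  AddMonoidAlgebra.mapDomain_injective (LinearMap.dualMap_injective_of_surjective hφ)

theorem evalAt_pullbackExp (φ : V →ₗ[ℂ] W) (f : AddMonoidAlgebra ℤ (Dual ℂ W)) (t : V) :
    evalAt (pullbackExp φ f) t = evalAt f (φ t) := by
  rw [evalAt, coeff_pullbackExp, Finsupp.sum_mapDomain_index (by simp) (by simp [add_mul])]
  rfl

theorem evalAt_substMonomials {ν : Type*} [Fintype ν] (w : ν → Dual ℂ V)
    (F : AddMonoidAlgebra ℤ (ν → ℂ)) (t : V) :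
    evalAt (substMonomials w F) t =
      F.coeff.sum fun c n => (n : ℂ) * Complex.exp (∑ i, c i * w i t) := by
  have hc : (substMonomials w F).coeff = F.coeff.mapDomain (Fintype.linearCombination ℂ w) := rfl
  rw [evalAt, hc, Finsupp.sum_mapDomain_index (by simp) (by simp [add_mul])]
  simp [Fintype.linearCombination_apply, LinearMap.sum_apply]

/-- A substitution of monomials does not change the value at a point where each variable agrees
with the monomial substituted for it. -/
theorem evalAt_substMonomials_substMonomials {ν : Type*} [Fintype ν] (w : ν → Dual ℂ V)
    (w' : ν → ν → ℂ) (F : AddMonoidAlgebra ℤ (ν → ℂ)) (t : V)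
    (h : ∀ i, Fintype.linearCombination ℂ w (w' i) t = w i t) :
    evalAt (substMonomials w (substMonomials w' F)) t = evalAt (substMonomials w F) t := by
  have hcomp : substMonomials w (substMonomials w' F) =
      substMonomials (fun i => Fintype.linearCombination ℂ w (w' i)) F := by
    apply AddMonoidAlgebra.coeff_injective
    change (F.coeff.mapDomain _).mapDomain _ = F.coeff.mapDomain _
    rw [← Finsupp.mapDomain_comp]
    congr 1
    funext c
    simp [Fintype.linearCombination_apply ℂ _ c, map_sum]
  rw [hcomp, evalAt_substMonomials, evalAt_substMonomials]
  simp only [h]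

theorem linearCombination_varExp {ν : Type*} [Fintype ν] [DecidableEq ν] (w : ν → W) (i : ν) :
    Fintype.linearCombination ℂ w (varExp i) = w i := by
  rw [varExp, Fintype.linearCombination_apply_single, one_smul]

end ExponentialSums

/-! ### The supercharacter of `M_x` as an Euler characteristic -/

section Supercharacters

variable {L : Type u} [AddCommGroup L] [Module ℂ L] [LieSuperalgebra L] (H : EvenAbelian L)
  (M : Type v) [AddCommGroup M] [Module ℂ M] [SuperSpace M] [LieSupermodule L M]

/-- The action of `h` on a module. -/
def cartanAct : H.carrier →ₗ[ℂ] End ℂ M := act ∘ₗ H.carrier.subtype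

theorem cartanAct_commute (s t : H.carrier) : Commute (cartanAct H M s) (cartanAct H M t) :=
  act_commute H M s t

theorem cartanAct_mem_part (i : ZMod 2) (t : H.carrier) (m : M) (hm : m ∈ part (V := M) i) :
    cartanAct H M t m ∈ part (V := M) i := by
  have h := act_mem (L := L) (H.le_even t.2) hm
  rwa [zero_add] at h

theorem mapDomain_apply_eq_sum_filter {α β : Type*} [DecidableEq β] (g : α → β) (f : α →₀ ℤ)
    (S : Finset α) (hS : f.support ⊆ S) (b : β) :
    f.mapDomain g b = ∑ a ∈ S with g a = b, f a := by
  rw [Finsupp.mapDomain, Finsupp.sum_of_support_subset _ hS _ (by simp), Finsupp.finsetSum_apply,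
    Finset.sum_filter]
  simp only [Finsupp.single_apply]

/-- Weights with the same pull-back to `V` have their multiplicities added, and their weight spaces
merge into one eigenspace of the pulled-back family. -/
theorem coeff_pullbackExp_sch [FiniteDimensional ℂ M] {V : Type*} [AddCommGroup V] [Module ℂ V]
    (φ : V →ₗ[ℂ] H.carrier) (ν : Dual ℂ V) :
    (pullbackExp φ (sch H M)).coeff ν =
      (jointDim (cartanAct H M ∘ₗ φ) (part 0) ν : ℤ) -
        (jointDim (cartanAct H M ∘ₗ φ) (part 1) ν : ℤ) := by
  classical
  have hcoeff : ∀ μ, (sch H M).coeff μ =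
      (jointDim (cartanAct H M) (part 0) μ : ℤ) - (jointDim (cartanAct H M) (part 1) μ : ℤ) :=
    fun μ => rfl
  have hfin := finite_jointSpace_ne_bot (cartanAct_commute H M)
  have hS : ∀ μ, jointSpace (cartanAct H M) μ ≠ ⊥ → μ ∈ hfin.toFinset := fun μ hμ => by
    simpa using hμ
  have hsupp : (sch H M).coeff.support ⊆ hfin.toFinset := by
    intro μ hμ
    refine hS μ fun hbot => Finsupp.mem_support_iff.1 hμ ?_
    rw [hcoeff, jointDim, jointDim, hbot, bot_inf_eq, bot_inf_eq, sub_self]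
  rw [coeff_pullbackExp, mapDomain_apply_eq_sum_filter _ _ _ hsupp,
    jointDim_comp (cartanAct_commute H M) (cartanAct_mem_part H M 0) φ ν _ hS,
    jointDim_comp (cartanAct_commute H M) (cartanAct_mem_part H M 1) φ ν _ hS,
    Nat.cast_sum, Nat.cast_sum, ← Finset.sum_sub_distrib]
  exact Finset.sum_congr rfl fun μ _ => hcoeff μ

variable {H M} {x : OddPart L}

/-- For odd `x` the bracket `[x, x]` acts as `2 x²`. -/
theorem imx_le_kerx (hx : bracket (x : L) (x : L) = 0) : imx x M ≤ kerx x M := by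
  intro m hm
  obtain ⟨w, rfl⟩ := mem_imx.1 hm
  have h := act_bracket (L := L) w x.2 x.2
  rw [hx, map_zero, LinearMap.zero_apply, superSign, if_pos ⟨rfl, rfl⟩, neg_smul, one_smul,
    sub_neg_eq_add, ← two_smul ℂ, eq_comm, smul_eq_zero, or_iff_right two_ne_zero] at h
  exact mem_kerx.2 h

/-- Since `x` is odd, the component of a preimage with the wrong parity contributes a term in both
parts, hence zero. -/
theorem map_act_part (i j : ZMod 2) (hij : i + 1 = j) :
    (part (V := M) i).map (act (x : L)) = part (V := M) j ⊓ imx x M := by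
  have hodd : ∀ i : ZMod 2, ∀ m ∈ part (V := M) i, act (x : L) m ∈ part (V := M) (i + 1) :=
    fun i m hm => add_comm 1 i ▸ act_mem (L := L) x.2 hm
  apply le_antisymm
  · rintro _ ⟨m, hm, rfl⟩
    exact ⟨hij ▸ hodd i m hm, m, rfl⟩
  · rintro _ ⟨hm, w, rfl⟩
    obtain ⟨w0, h0, w1, h1, rfl⟩ := exists_decomp w
    have e0 : act (x : L) w0 ∈ part (V := M) 1 := hodd 0 w0 h0
    have e1 : act (x : L) w1 ∈ part (V := M) 0 := hodd 1 w1 h1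
    rw [map_add] at hm ⊢
    have hdisj := Submodule.disjoint_def.1 (isCompl_part (V := M)).disjoint
    fin_cases i
    · obtain rfl : j = 1 := hij.symm
      have : act (x : L) w1 ∈ part (V := M) 1 := by
        simpa using (part (V := M) 1).sub_mem hm e0
      rw [hdisj _ e1 this, add_zero]
      exact ⟨w0, h0, rfl⟩
    · obtain rfl : j = 0 := hij.symm
      have : act (x : L) w0 ∈ part (V := M) 0 := by
        simpa using (part (V := M) 0).sub_mem hm e1
      rw [hdisj _ this e0, zero_add]
      exact ⟨w1, h1, rfl⟩

theorem act_x_cartanAct (t : hCent H x) (m : M) :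
    act (x : L) (cartanAct H M t m) = cartanAct H M t (act (x : L) m) := by
  change act (x : L) (act ((t : H.carrier) : L) m) = act ((t : H.carrier) : L) (act (x : L) m)
  have ht : bracket (x : L) ((t : H.carrier) : L) = 0 := mem_kerx.1 t.2
  rw [act_x_act (H.le_even t.1.2), ht, superSign_zero_right, one_smul, map_zero,
    LinearMap.zero_apply, zero_add]

theorem kerx_mapsTo (t : hCent H x) (m : M) (hm : m ∈ kerx x M) :
    (cartanAct H M ∘ₗ (hCent H x).subtype) t m ∈ kerx x M := by
  rw [mem_kerx] at hm ⊢
  rw [LinearMap.comp_apply, Submodule.subtype_apply, act_x_cartanAct, hm, map_zero]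

/-- Rank–nullity for `x` from one parity to the other, weight by weight for `h^x`. -/
theorem jointDim_part [FiniteDimensional ℂ M] (i j : ZMod 2) (hij : i + 1 = j)
    (ν : Dual ℂ (hCent H x)) :
    jointDim (cartanAct H M ∘ₗ (hCent H x).subtype) (part i) ν =
      jointDim (cartanAct H M ∘ₗ (hCent H x).subtype) (part j ⊓ imx x M) ν +
        jointDim (cartanAct H M ∘ₗ (hCent H x).subtype) (part i ⊓ kerx x M) ν := by
  rw [← map_act_part i j hij]
  exact jointDim_eq_map_add_ker (T := cartanAct H M ∘ₗ (hCent H x).subtype)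
    (T' := cartanAct H M ∘ₗ (hCent H x).subtype) (fun _ _ => cartanAct_commute H M _ _)
    (fun _ _ => cartanAct_commute H M _ _) (act (x : L)) act_x_cartanAct
    (fun t => cartanAct_mem_part H M i t) ν

/-- Rank–nullity for the projection `Ker x → M_x`, whose kernel is `x M` because `x² = 0`. -/
theorem jointDim_part_inf_kerx [FiniteDimensional ℂ M] (hx : bracket (x : L) (x : L) = 0)
    (i : ZMod 2) (ν : Dual ℂ (hCent H x)) :
    jointDim (cartanAct H M ∘ₗ (hCent H x).subtype) (part i ⊓ kerx x M) ν =
      jointDim (cartanAct (H.ds x) (DSMod x M) ∘ₗ toHx H x) (part i) ν +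
        jointDim (cartanAct H M ∘ₗ (hCent H x).subtype) (part i ⊓ imx x M) ν := by
  set T := cartanAct H M ∘ₗ (hCent H x).subtype
  have hT : ∀ s t, Commute (T s) (T t) := fun _ _ => cartanAct_commute H M _ _
  set K := restrictFamily T (kerx x M) kerx_mapsTo
  have hK : ∀ s t, Commute (K s) (K t) := restrictFamily_commute kerx_mapsTo hT
  have hsub : ∀ Q : Submodule ℂ (kerx x M), (∀ t, ∀ v ∈ Q, K t v ∈ Q) →
      jointDim K Q ν = jointDim T (Q.map (kerx x M).subtype) ν := by
    intro Q hQ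
    rw [jointDim_eq_map_add_ker hK hT (kerx x M).subtype (fun _ _ => rfl) hQ ν,
      Submodule.ker_subtype, inf_bot_eq, jointDim, jointDim, inf_bot_eq, finrank_bot, add_zero]
  have hmk : ∀ t n, DSMod.mk x M (K t n) =
      (cartanAct (H.ds x) (DSMod x M) ∘ₗ toHx H x) t (DSMod.mk x M n) := fun _ _ => rfl
  have hP : ∀ t, ∀ v ∈ (part (V := M) i).comap (kerx x M).subtype,
      K t v ∈ (part (V := M) i).comap (kerx x M).subtype :=
    fun t v hv => cartanAct_mem_part H M i t v hv
  have hPk : ∀ t, ∀ v ∈ (part (V := M) i).comap (kerx x M).subtype ⊓ LinearMap.ker (DSMod.mk x M),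
      K t v ∈ (part (V := M) i).comap (kerx x M).subtype ⊓ LinearMap.ker (DSMod.mk x M) :=
    fun t v hv => ⟨hP t v hv.1,
      LinearMap.mem_ker.2 (by rw [hmk, LinearMap.mem_ker.1 hv.2, map_zero])⟩
  have h := jointDim_eq_map_add_ker hK (fun _ _ => cartanAct_commute (H.ds x) (DSMod x M) _ _)
    (DSMod.mk x M) hmk hP ν
  rw [hsub _ hP, hsub _ hPk, Submodule.map_comap_subtype, inf_comm] at h
  have him : ((part (V := M) i).comap (kerx x M).subtype ⊓ LinearMap.ker (DSMod.mk x M)).map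
      (kerx x M).subtype = part i ⊓ imx x M := by
    ext m
    constructor
    · rintro ⟨m, ⟨hm, hm'⟩, rfl⟩
      exact ⟨hm, DSMod.mk_eq_zero.1 hm'⟩
    · rintro ⟨hm, hm'⟩
      exact ⟨⟨m, imx_le_kerx hx hm'⟩, ⟨hm, DSMod.mk_eq_zero.2 hm'⟩, rfl⟩
  rw [him] at h
  exact h

/-- The supercharacter of `M_x` is the restriction of the supercharacter of `M`. -/
theorem pullbackExp_sch_DSMod [FiniteDimensional ℂ M] (hx : bracket (x : L) (x : L) = 0) :
    pullbackExp (toHx H x) (sch (H.ds x) (DSMod x M)) =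
      pullbackExp (hCent H x).subtype (sch H M) := by
  apply AddMonoidAlgebra.coeff_injective
  ext ν
  rw [coeff_pullbackExp_sch, coeff_pullbackExp_sch]
  -- In the difference of the two parities the contributions of `x M` cancel: each occurs once
  -- through the image of `x` and once through `Ker x`.
  have h0 := jointDim_part (M := M) 0 1 rfl ν
  have h1 := jointDim_part (M := M) 1 0 rfl ν
  have k0 := jointDim_part_inf_kerx (M := M) hx 0 ν
  have k1 := jointDim_part_inf_kerx (M := M) hx 1 ν
  omega

end Supercharacters

/-! ### Existence and uniqueness of `ds_x` -/

section DSHom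

variable {L : Type u} [AddCommGroup L] [Module ℂ L] [LieSuperalgebra L] {H : EvenAbelian L}
  {x : OddPart L}

theorem toHx_surjective : Function.Surjective (toHx H x) :=
  LinearMap.surjective_rangeRestrict _

/-- The elements with this property form a subring, so the generators `sch M` suffice, and for these
`sch M_x` is the witness. -/
theorem pullbackExp_subtype_mem_map (hx : bracket (x : L) (x : L) = 0)
    (f : superCharRing.{u, v} H) :
    pullbackExp (hCent H x).subtype f.1 ∈
      (superCharRing.{u, v} (H.ds x)).map (pullbackExp (toHx H x)) := by
  have hle : superCharRing.{u, v} H ≤ ((superCharRing.{u, v} (H.ds x)).map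
      (pullbackExp (toHx H x))).comap (pullbackExp (hCent H x).subtype) := by
    refine Subring.closure_le.2 ?_
    rintro _ ⟨M, _, _, _, _, _, rfl⟩
    exact ⟨_, (schClass (H.ds x) (DSMod x M)).2, pullbackExp_sch_DSMod hx⟩
  exact hle f.2

/-- The homomorphism `[M] ↦ [M_x]` of supercharacter rings. -/
noncomputable def dsHom (hx : bracket (x : L) (x : L) = 0) :
    superCharRing.{u, v} H →+* superCharRing.{u, v} (H.ds x) :=
  ((superCharRing.{u, v} (H.ds x)).equivMapOfInjective (pullbackExp (toHx H x))
    (pullbackExp_injective toHx_surjective)).symm.toRingHom.comp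
    (((pullbackExp (hCent H x).subtype).comp (superCharRing.{u, v} H).subtype).codRestrict _
      (pullbackExp_subtype_mem_map hx))

theorem pullbackExp_dsHom (hx : bracket (x : L) (x : L) = 0) (f : superCharRing.{u, v} H) :
    pullbackExp (toHx H x) (dsHom hx f).1 = pullbackExp (hCent H x).subtype f.1 :=
  congrArg Subtype.val (((superCharRing.{u, v} (H.ds x)).equivMapOfInjective
    (pullbackExp (toHx H x)) (pullbackExp_injective toHx_surjective)).apply_symm_apply
    ⟨_, pullbackExp_subtype_mem_map hx f⟩)

theorem isDS_dsHom (hx : bracket (x : L) (x : L) = 0) : IsDS.{u, v} H x (dsHom hx) := by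
  intro M _ _ _ _ _
  apply Subtype.ext
  apply pullbackExp_injective (toHx_surjective (H := H) (x := x))
  rw [pullbackExp_dsHom]
  exact (pullbackExp_sch_DSMod hx).symm

theorem ringHom_closure_ext {R S : Type*} [Ring R] [Ring S] {s : Set R}
    {φ ψ : Subring.closure s →+* S}
    (h : ∀ (f : R) (hf : f ∈ s), φ ⟨f, Subring.subset_closure hf⟩ =
      ψ ⟨f, Subring.subset_closure hf⟩) : φ = ψ := by
  have hle : Subring.closure s ≤ (φ.eqLocus ψ).map (Subring.closure s).subtype :=
    Subring.closure_le.2 fun f hf => ⟨⟨f, Subring.subset_closure hf⟩, h f hf, rfl⟩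
  ext f
  obtain ⟨g, hg, hgf⟩ := hle f.2
  obtain rfl : g = f := Subtype.ext hgf
  exact hg

/-- Both sides are ring homomorphisms in `f` and agree on the generators. With injectivity of the
pull-back this determines `ds`. -/
theorem IsDS.pullbackExp_eq (hx : bracket (x : L) (x : L) = 0)
    {ds : superCharRing.{u, v} H →+* superCharRing.{u, v} (H.ds x)} (hds : IsDS H x ds)
    (f : superCharRing.{u, v} H) :
    pullbackExp (toHx H x) (ds f).1 = pullbackExp (hCent H x).subtype f.1 := by
  refine RingHom.congr_fun (ringHom_closure_ext
    (φ := ((pullbackExp (toHx H x)).comp (superCharRing.{u, v} (H.ds x)).subtype).comp ds)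
    (ψ := (pullbackExp (hCent H x).subtype).comp (superCharRing.{u, v} H).subtype) ?_) f
  rintro _ ⟨M, _, _, _, _, _, rfl⟩
  exact (congrArg (fun g => pullbackExp (toHx H x) g.1) (hds M)).trans (pullbackExp_sch_DSMod hx)

theorem existsUnique_isDS (hx : bracket (x : L) (x : L) = 0) :
    ∃! ds : superCharRing.{u, v} H →+* superCharRing.{u, v} (H.ds x), IsDS H x ds := by
  refine ⟨dsHom hx, isDS_dsHom hx, fun ds hds => RingHom.ext fun f => Subtype.ext ?_⟩
  apply pullbackExp_injective (toHx_surjective (H := H) (x := x))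
  rw [hds.pullbackExp_eq hx, pullbackExp_dsHom]

end DSHom

end SuperLie

/-! ### The explicit formulas for `ds_x` -/

theorem mainTheorem2 {L : Type u} [AddCommGroup L] [Module ℂ L] [FiniteDimensional ℂ L]
    [LieSuperalgebra L] (H : EvenAbelian L) (hH : H.IsCartan) (hL : IsContragredientOrGL H)
    (Φ : InvariantForm L) {k : ℕ} (β : Fin k → H.Weight) (hβ : IsIsotropicSet Φ H β)
    (xβ : Fin k → L) (hxβ : ∀ i, xβ i ∈ rootSpace H (β i)) (hxβ0 : ∀ i, xβ i ≠ 0)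
    (x : OddPart L) (hx : (x : L) = ∑ i, xβ i) :
    LieSuperalgebra.bracket (x : L) (x : L) = 0 ∧
    (∃! ds : superCharRing.{u, v} H →+* superCharRing.{u, v} (H.ds x), IsDS H x ds) ∧
    ∀ ds : superCharRing.{u, v} H →+* superCharRing.{u, v} (H.ds x), IsDS H x ds →
    ∀ f : superCharRing.{u, v} H,
    -- (1) restriction to `h_x`, for every embedding of `g_x` into `g^x`
    (∀ (K : Submodule ℂ L) (hK : IsEmbeddedDS x K),
      pullbackExp (embeddedToHx H hK) (ds f).1 = pullbackExp (K.comap H.carrier.subtype).subtype f.1 ∧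
      ∀ t : ↥(K.comap H.carrier.subtype),
        evalAt (ds f).1 (embeddedToHx H hK t) = evalAt f.1 (t : H.carrier)) ∧
    -- (2) a single root
    (∀ (p q : ℕ) (ε : Fin (p + 1) → H.Weight) (δ : Fin (q + 1) → H.Weight),
      Set.range β = {ε 0 - δ 0} →
      ∀ F, substMonomials (Sum.elim ε δ) F = f.1 → ∀ t : hCent H x,
        evalAt (ds f).1 (toHx H x t) =
          evalAt (substMonomials (Sum.elim ε δ)
            (substMonomials (Function.update varExp (Sum.inl 0) (varExp (Sum.inr 0))) F))
            (t : H.carrier)) ∧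
    (∀ (ε : Fin 3 → H.Weight) (δ : Fin 1 → H.Weight),
      Set.range β = {(1 / 2 : ℂ) • (ε 0 + ε 1 + ε 2 - δ 0)} →
      ∀ F, substMonomials
          (Sum.elim (fun i => (1 / 2 : ℂ) • ε i) (fun j => (1 / 2 : ℂ) • δ j)) F = f.1 →
      ∀ t : hCent H x,
        evalAt (ds f).1 (toHx H x t) =
          evalAt (substMonomials
            (Sum.elim (fun i => (1 / 2 : ℂ) • ε i) (fun j => (1 / 2 : ℂ) • δ j))
            (substMonomials (Function.update varExp (Sum.inr 0)
              (varExp (Sum.inl 0) + varExp (Sum.inl 1) + varExp (Sum.inl 2))) F))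
            (t : H.carrier)) ∧
    (∀ ε : Fin 3 → H.Weight, Set.range β = {ε 0 - ε 1 - ε 2} →
      ∀ F, substMonomials ε F = f.1 → ∀ t : hCent H x,
        evalAt (ds f).1 (toHx H x t) =
          evalAt (substMonomials ε
            (substMonomials (Function.update varExp 0 (varExp 1 + varExp 2)) F)) (t : H.carrier)) ∧
    -- (3) several roots `a_i ε_(r i) - b_i δ_(s i)`
    (∀ (p q : ℕ) (ε : Fin p → H.Weight) (δ : Fin q → H.Weight)
      (r : Fin k → Fin p) (s : Fin k → Fin q) (a b : Fin k → ℤ),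
      (∀ i, (a i = 1 ∨ a i = -1) ∧ (b i = 1 ∨ b i = -1)) →
      (∀ i, β i = a i • ε (r i) - b i • δ (s i)) →
      ∀ F, substMonomials (Sum.elim ε δ) F = f.1 → ∀ t : hCent H x,
        evalAt (ds f).1 (toHx H x t) =
          evalAt (substMonomials (Sum.elim ε δ)
            (substMonomials (Sum.elim
              (Function.extend r (fun i => (a i * b i) • varExp (Sum.inr (s i)))
                (fun j => varExp (Sum.inl j)))
              (fun j => varExp (Sum.inr j))) F))
            (t : H.carrier)) ∧
    -- (4) restriction to the common zero space of `β_1, …, β_k`, which is `h^x`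
    ((∀ t : H.carrier, t ∈ hCent H x ↔ ∀ i, β i t = 0) ∧
      pullbackExp (toHx H x) (ds f).1 = pullbackExp (hCent H x).subtype f.1 ∧
      ∀ t : hCent H x, evalAt (ds f).1 (toHx H x t) = evalAt f.1 (t : H.carrier)) := by
  have hxx : LieSuperalgebra.bracket (x : L) (x : L) = 0 := by
    rw [hx]
    exact bracket_self_eq_zero_of_isIsotropicSet hH hL Φ hβ hxβ
  refine ⟨hxx, existsUnique_isDS hxx, fun ds hds f => ?_⟩
  have hcent : ∀ t : H.carrier, t ∈ hCent H x ↔ ∀ i, β i t = 0 :=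
    mem_hCent_iff (fun i j h => by_contra fun hij => (hβ.ne i j hij).1 h) hxβ hxβ0 hx
  have hpull := hds.pullbackExp_eq hxx f
  have heval : ∀ t : hCent H x, evalAt (ds f).1 (toHx H x t) = evalAt f.1 (t : H.carrier) := by
    intro t
    rw [← evalAt_pullbackExp, hpull, evalAt_pullbackExp]
    rfl
  have hzero : ∀ t : hCent H x, ∀ μ ∈ Set.range β, μ (t : H.carrier) = 0 := by
    rintro t _ ⟨i, rfl⟩
    exact (hcent t).1 t.2 i
  refine ⟨fun K hK => ⟨?_, fun t => heval _⟩, ?_, ?_, ?_, ?_, hcent, hpull, heval⟩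
  -- The identification of `h ∩ K` with `h_x` factors through the inclusion into `h^x`, so the
  -- restriction to `h^x` restricts further.
  · rw [embeddedToHx, pullbackExp_comp, hpull, ← pullbackExp_comp]
    rfl
  · intro p q ε δ hB F hF t
    have h0 := hzero t (ε 0 - δ 0) (hB.symm.subset rfl)
    rw [LinearMap.sub_apply, sub_eq_zero] at h0
    rw [heval, ← hF, evalAt_substMonomials_substMonomials]
    intro i
    by_cases hi : i = Sum.inl 0
    · subst hi
      rw [Function.update_self, linearCombination_varExp]
      exact h0.symm
    · rw [Function.update_of_ne hi, linearCombination_varExp]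
  · intro ε δ hB F hF t
    have h0 := hzero t _ (hB.symm.subset rfl)
    rw [LinearMap.smul_apply, smul_eq_zero, or_iff_right (by norm_num), LinearMap.sub_apply,
      sub_eq_zero, LinearMap.add_apply, LinearMap.add_apply] at h0
    rw [heval, ← hF, evalAt_substMonomials_substMonomials]
    intro i
    by_cases hi : i = Sum.inr 0
    · subst hi
      rw [Function.update_self, map_add, map_add, linearCombination_varExp,
        linearCombination_varExp, linearCombination_varExp]
      simp only [Sum.elim_inl, Sum.elim_inr, LinearMap.add_apply, LinearMap.smul_apply]
      rw [← smul_add, ← smul_add, h0]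
    · rw [Function.update_of_ne hi, linearCombination_varExp]
  · intro ε hB F hF t
    have h0 := hzero t _ (hB.symm.subset rfl)
    rw [LinearMap.sub_apply, LinearMap.sub_apply, sub_sub, sub_eq_zero] at h0
    rw [heval, ← hF, evalAt_substMonomials_substMonomials]
    intro i
    by_cases hi : i = 0
    · subst hi
      rw [Function.update_self, map_add, linearCombination_varExp, linearCombination_varExp,
        LinearMap.add_apply, h0]
    · rw [Function.update_of_ne hi, linearCombination_varExp]
  · intro p q ε δ r s a b hab hB F hF t
    rw [heval, ← hF, evalAt_substMonomials_substMonomials]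
    rintro (j | j)
    · rw [Sum.elim_inl]
      -- If several `i` have `r i = j`, `Function.extend` picks one; any choice works, since every
      -- `β i` vanishes at `t`.
      by_cases hj : ∃ i, r i = j
      · have hi := hj.choose_spec
        have h0 := (hcent t).1 t.2 hj.choose
        rw [hB, hi, LinearMap.sub_apply, LinearMap.smul_apply, LinearMap.smul_apply] at h0
        rw [Function.extend_def, dif_pos hj, map_zsmul, linearCombination_varExp, Sum.elim_inr,
          Sum.elim_inl, LinearMap.smul_apply, mul_smul, ← sub_eq_zero.1 h0, smul_smul]
        -- Here `a i * a i = 1` turns `a i ε = b i δ` into `ε = a i b i δ` at `t`, which is why the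
        -- substituted exponent is `a i * b i`.
        rcases (hab hj.choose).1 with h | h <;> simp [h]
      · rw [Function.extend_apply' _ _ _ hj, linearCombination_varExp]
    · rw [Sum.elim_inr, linearCombination_varExp]
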